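/- Let $(M,g)$ be a connected smooth Riemannian manifold of dimension $3$, with Levi-Civita connection $\nabla$, curvature operators $R(X,Y)=\nabla_X\nabla_Y-\nabla_Y\nabla_X-\nabla_{[X,Y]}$, curvature tensor $R(X,Y,V,W)=g(R(X,Y)V,W)$, and metrical endomorphisms $(X\wedge_g Y)V=g(Y,V)X-g(X,V)Y$. For linearly independent tangent vectors $v,w$ at a point, the sectional curvature of the plane $v\wedge w$ is $$K(v\wedge w)=\frac{R(v,w,w,v)}{g(v,v)\,g(w,w)-g(v,w)^2}.$$ Let $R\cdot R$ and $\wedge_g\cdot R$ be the $(0,6)$-tensors obtained by letting the endomorphisms $A=R(X,Y)$, respectively $A=X\wedge_g Y$, act as derivations on the $(0,4)$-tensor $R$: $$-R(AV_1,V_2,V_3,V_4)-R(V_1,AV_2,V_3,V_4)-R(V_1,V_2,AV_3,V_4)-R(V_1,V_2,V_3,AV_4).$$ Assume that the multiplicities of the principal Ricci curvatures (the eigenvalues of the Ricci tensor $S(X)=\sum_t R(X,E_t)E_t$, where $(E_t)$ is an orthonormal frame) are constant on $M$. Then the following are equivalent. (a) $(M,g)$ is Deszcz symmetric (pseudo symmetric):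 there is a function $L:M\to\mathbb{R}$ with $R\cdot R=L\,\wedge_g\cdot R$. (b) $(M,g)$ is a real space form (there is a real number $c$ such that all sectional curvatures at all points of $M$ are equal to $c$), or $(M,g)$ is a quasi space form, that is: there are a smooth distribution $D$ of dimension $1$ on $M$, with orthogonal complement $D^\perp$ of dimension $2$, and two real functions $\overline K$ and $K^\perp$ on $M$ with $\overline K(p)\neq K^\perp(p)$ for all $p\in M$, such that at every point, for all orthonormal $X\in D$ and $X^\perp,Y^\perp\in D^\perp$ and all $\theta\in[0,\pi/2]$, $$K\big((X\cos\theta+X^\perp\sin\theta)\wedge Y^\perp\big)=\overline K\cos^2\theta+K^\perp\sin^2\theta.$$ -/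

import Mathlib

open Bundle Manifold Module
open scoped ContDiff Topology RealInnerProductSpace

noncomputable section

namespace RiemGeom

/-! Throughout, `M` is a manifold modelled on `ℝⁿ` (without boundary), whose tangent spaces carry the
inner products `⟪·, ·⟫` of a Riemannian metric `g`. -/

instance instFiniteDimensionalTangentSpace (n : ℕ) {M : Type*} [TopologicalSpace M]
    [ChartedSpace (EuclideanSpace ℝ (Fin n)) M] (p : M) :
    FiniteDimensional ℝ (TangentSpace (𝓡 n) p) :=
  inferInstanceAs (FiniteDimensional ℝ (EuclideanSpace ℝ (Fin n)))

variable {n : ℕ} {M : Type*} [TopologicalSpace M] [ChartedSpace (EuclideanSpace ℝ (Fin n)) M]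
  [IsManifold (𝓡 n) ∞ M] [RiemannianBundle (fun p : M => TangentSpace (𝓡 n) p)]

/-- A local vector field with value `u` at `p`: it is constant in the preferred trivialization of
the tangent bundle around `p`, hence smooth near `p`. -/
def ext {p : M} (u : TangentSpace (𝓡 n) p) : (y : M) → TangentSpace (𝓡 n) y :=
  FiberBundle.extend (EuclideanSpace ℝ (Fin n)) u

/-- An orthonormal basis of the tangent space at `p`. -/
def frame (p : M) :
    OrthonormalBasis (Fin (finrank ℝ (TangentSpace (𝓡 n) p))) ℝ (TangentSpace (𝓡 n) p) :=
  stdOrthonormalBasis ℝ (TangentSpace (𝓡 n) p)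

/-- The Koszul expression, which is the value `g(∇_X Y, Z)` at `p`:
`½ (X g(Y,Z) + Y g(Z,X) - Z g(X,Y) + g([X,Y],Z) - g([Y,Z],X) + g([Z,X],Y))`. -/
def koszul (X Y Z : (y : M) → TangentSpace (𝓡 n) y) (p : M) : ℝ :=
  (1 / 2 : ℝ) *
    (mvfderiv (𝓡 n) (fun y => ⟪Y y, Z y⟫) p (X p)
      + mvfderiv (𝓡 n) (fun y => ⟪Z y, X y⟫) p (Y p)
      - mvfderiv (𝓡 n) (fun y => ⟪X y, Y y⟫) p (Z p)
      + ⟪VectorField.mlieBracket (𝓡 n) X Y p, Z p⟫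
      - ⟪VectorField.mlieBracket (𝓡 n) Y Z p, X p⟫
      + ⟪VectorField.mlieBracket (𝓡 n) Z X p, Y p⟫)

/-- The Levi-Civita connection: `nabla Y p u` is the covariant derivative `∇_u Y` at `p` of the
vector field `Y` in the direction `u`, i.e. the tangent vector whose inner products are given by
the Koszul formula. -/
def nabla (Y : (y : M) → TangentSpace (𝓡 n) y) (p : M) (u : TangentSpace (𝓡 n) p) :
    TangentSpace (𝓡 n) p :=
  ∑ i, koszul (ext u) Y (ext (frame p i)) p • frame p i

/-- The curvature operator `R(u,v) w`, computed from local vector fields `U, V, W` that extend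
`u, v, w`, as `∇_U ∇_V W - ∇_V ∇_U W - ∇_{[U,V]} W` at `p`. -/
def curvOp (p : M) (u v w : TangentSpace (𝓡 n) p) : TangentSpace (𝓡 n) p :=
  nabla (fun y => nabla (ext w) y (ext v y)) p u
    - nabla (fun y => nabla (ext w) y (ext u y)) p v
    - nabla (ext w) p (VectorField.mlieBracket (𝓡 n) (ext u) (ext v) p)

/-- The Riemann-Christoffel curvature tensor `R(u,v,w,z) = g(R(u,v)w, z)`. -/
def Riem (p : M) (u v w z : TangentSpace (𝓡 n) p) : ℝ := ⟪curvOp p u v w, z⟫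

/-- The metrical endomorphism `(u ∧_g v) w = g(v,w) u - g(u,w) v`. -/
def wedgeOp (p : M) (u v w : TangentSpace (𝓡 n) p) : TangentSpace (𝓡 n) p :=
  ⟪v, w⟫ • u - ⟪u, w⟫ • v

/-- The tensor `G(u,v,w,z) = g((u ∧_g v) w, z)`. -/
def G (p : M) (u v w z : TangentSpace (𝓡 n) p) : ℝ := ⟪wedgeOp p u v w, z⟫

/-- The sectional curvature of the plane spanned by (linearly independent) `v, w`. -/
def sectionalCurvature (p : M) (v w : TangentSpace (𝓡 n) p) : ℝ := Riem p v w w v / G p v w w v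

/-- The action of an endomorphism `A` of a tangent space as a derivation on a (0,4) tensor. -/
def derivAct {p : M} (A : TangentSpace (𝓡 n) p → TangentSpace (𝓡 n) p)
    (F : TangentSpace (𝓡 n) p →
      TangentSpace (𝓡 n) p → TangentSpace (𝓡 n) p → TangentSpace (𝓡 n) p → ℝ)
    (v₁ v₂ v₃ v₄ : TangentSpace (𝓡 n) p) : ℝ :=
  -F (A v₁) v₂ v₃ v₄ - F v₁ (A v₂) v₃ v₄ - F v₁ v₂ (A v₃) v₄ - F v₁ v₂ v₃ (A v₄)

/-- The (0,6) tensor `(R·R)(v₁,v₂,v₃,v₄; x,y)`. -/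
def RdotR (p : M) (v₁ v₂ v₃ v₄ x y : TangentSpace (𝓡 n) p) : ℝ :=
  derivAct (curvOp p x y) (Riem p) v₁ v₂ v₃ v₄

/-- The Tachibana tensor `(∧_g·R)(v₁,v₂,v₃,v₄; x,y)`. -/
def tachibana (p : M) (v₁ v₂ v₃ v₄ x y : TangentSpace (𝓡 n) p) : ℝ :=
  derivAct (wedgeOp p x y) (Riem p) v₁ v₂ v₃ v₄

variable (n M)

/-- Deszcz symmetric (pseudo symmetric) spaces: `R·R = L ∧_g·R` for a function `L : M → ℝ`. -/
def IsDeszczSymmetric : Prop :=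
  ∃ L : M → ℝ, ∀ (p : M) (v₁ v₂ v₃ v₄ x y : TangentSpace (𝓡 n) p),
    RdotR p v₁ v₂ v₃ v₄ x y = L p * tachibana p v₁ v₂ v₃ v₄ x y

/-- Real space forms: all sectional curvatures at all points equal one real constant. -/
def IsRealSpaceForm : Prop :=
  ∃ c : ℝ, ∀ (p : M) (v w : TangentSpace (𝓡 n) p), LinearIndependent ℝ ![v, w] →
    sectionalCurvature p v w = c

variable {n M}

/-- `D` is a smooth distribution of dimension `q`: locally spanned by `q` smooth, pointwise linearly
independent vector fields. -/
def IsSmoothDistribution (q : ℕ) (D : (p : M) → Submodule ℝ (TangentSpace (𝓡 n) p)) : Prop :=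
  ∀ p : M, ∃ U : Set M, IsOpen U ∧ p ∈ U ∧ ∃ X : Fin q → (y : M) → TangentSpace (𝓡 n) y,
    (∀ i, ContMDiffOn (𝓡 n) (𝓡 n).tangent ∞
      (fun y => (⟨y, X i y⟩ : TangentBundle (𝓡 n) M)) U) ∧
    ∀ y ∈ U, LinearIndependent ℝ (fun i => X i y) ∧
      D y = Submodule.span ℝ (Set.range fun i => X i y)

/-- The curvature condition of a (1) quasi space form, with respect to `D` and its orthogonal
complement. -/
def QuasiConstantOne (D : (p : M) → Submodule ℝ (TangentSpace (𝓡 n) p)) : Prop :=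
  ∃ Kbar Kperp : M → ℝ, (∀ p, Kbar p ≠ Kperp p) ∧
    ∀ (p : M) (X X' Y' : TangentSpace (𝓡 n) p), X ∈ D p → X' ∈ (D p)ᗮ → Y' ∈ (D p)ᗮ →
      Orthonormal ℝ ![X, X', Y'] → ∀ θ ∈ Set.Icc (0 : ℝ) (Real.pi / 2),
        sectionalCurvature p (Real.cos θ • X + Real.sin θ • X') Y'
          = Kbar p * Real.cos θ ^ 2 + Kperp p * Real.sin θ ^ 2

/-- The curvature condition of a (q) quasi space form with `q > 1`, with respect to `D` and its
orthogonal complement. -/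
def QuasiConstantMany (D : (p : M) → Submodule ℝ (TangentSpace (𝓡 n) p)) : Prop :=
  ∃ K Kperp : M → ℝ, (∀ p, K p ≠ Kperp p) ∧
    ∀ (p : M) (X Y X' Y' : TangentSpace (𝓡 n) p), X ∈ D p → Y ∈ D p → X' ∈ (D p)ᗮ → Y' ∈ (D p)ᗮ →
      Orthonormal ℝ ![X, Y, X', Y'] →
      ∀ θ ∈ Set.Icc (0 : ℝ) (Real.pi / 2), ∀ φ ∈ Set.Icc (0 : ℝ) (Real.pi / 2),
        sectionalCurvature p (Real.cos θ • X + Real.sin θ • X') (Real.cos φ • Y + Real.sin φ • Y')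
          = K p * Real.cos θ ^ 2 * Real.cos φ ^ 2 + Kperp p * Real.sin θ ^ 2 * Real.sin φ ^ 2
            + (K p + Kperp p) / 2
              * (Real.cos θ ^ 2 * Real.sin φ ^ 2 + Real.sin θ ^ 2 * Real.cos φ ^ 2)

variable (n M)

/-- Quasi space forms (spaces of quasi constant curvature): for some `q` with `1 ≤ q ≤ n - q` there
are orthogonally complementary distributions of dimensions `q` and `n - q`, such that the sectional
curvatures depend on the position of the planes with respect to them as prescribed. -/
def IsQuasiSpaceForm : Prop :=
  ∃ q : ℕ, 1 ≤ q ∧ 2 * q ≤ n ∧ ∃ D : (p : M) → Submodule ℝ (TangentSpace (𝓡 n) p),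
    IsSmoothDistribution q D ∧
      (q = 1 → QuasiConstantOne D) ∧ (1 < q → QuasiConstantMany D)

variable {n M}

/-- The (1,1) Ricci tensor at `p`: the linear map sending a vector `u` of an orthonormal basis `e`
to `∑ₜ R(u, eₜ) eₜ`. -/
def ricciOp (p : M) : TangentSpace (𝓡 n) p →ₗ[ℝ] TangentSpace (𝓡 n) p :=
  (frame p).toBasis.constr ℝ fun i => ∑ t, curvOp p (frame p i) (frame p t) (frame p t)

variable (n)

/-- The multiplicity of `ρ` as a principal Ricci curvature at `p` (`0` if it is none). -/
def ricciMultiplicity (p : M) (ρ : ℝ) : ℕ :=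
  finrank ℝ (End.eigenspace (ricciOp p : TangentSpace (𝓡 n) p →ₗ[ℝ] TangentSpace (𝓡 n) p) ρ)

variable (M)

/-- The multiplicities of the principal Ricci curvatures are constant: for each `k ≥ 1`, the number
of principal Ricci curvatures of multiplicity `k` is the same at all points. -/
def ConstantRicciMultiplicities : Prop :=
  ∀ k : ℕ, 1 ≤ k → ∀ p p' : M,
    {ρ : ℝ | ricciMultiplicity n p ρ = k}.ncard
      = {ρ : ℝ | ricciMultiplicity n p' ρ = k}.ncard

end RiemGeom

end

/-! In dimension three the curvature is diagonal in an eigenframe a, b, c of the Ricci operator: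
R(a,b) = z a∧b, R(a,c) = y a∧c, R(b,c) = x b∧c (`IsAlgCurv.exists_frame`). There pseudo symmetry
yields (z - L)(x - y) = 0 and its cyclic versions, so x, y, z cannot be pairwise distinct. Two equal
ones give the normal form `HasForm`: for a unit vector ξ, planes through ξ have curvature α + β and
the plane orthogonal to ξ has curvature α (`exists_hasForm`). Conversely, this form satisfies the
condition with L = α + β (`HasForm.pseudo_symmetric`). So (a) says that the curvature has the normal
form at every point. Constant curvature is the case β = 0, and quasi constant curvature is the case
where ξ spans D, α is the curvature of D^⊥ and α + β that of the planes through D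
(`hasForm_of_quasi`).

It remains to pass from points to the manifold. The Ricci operator is (2α + β) id + β ξ⊗ξ, which has
a triple eigenvalue exactly when β = 0; constant multiplicities therefore make β vanish everywhere
or nowhere. If β = 0 everywhere, Schur's lemma, a consequence of the second Bianchi identity, makes
α constant. If β vanishes nowhere, the pointwise chosen ξ must be shown to span a smooth line field:
with S the Ricci operator and χ its characteristic polynomial, χ'(S) has smooth coefficients, kills
the double eigenspace and has image spanned by ξ (`isSmoothDistribution_span`).

All this rests on the standard properties of the Koszul connection: it is metric and torsion free,
and its curvature is tensorial with the usual symmetries. -/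

open Bundle Manifold Module
open scoped ContDiff Topology RealInnerProductSpace
noncomputable section
namespace RiemGeom

/-! ### Smooth vector fields -/

section

variable {n : ℕ} {M : Type*} [TopologicalSpace M] [ChartedSpace (EuclideanSpace ℝ (Fin n)) M]
  [IsManifold (𝓡 n) ∞ M]

/-- Smoothness at `p` of a vector field. -/
abbrev SmoothAt (X : (y : M) → TangentSpace (𝓡 n) y) (p : M) : Prop :=
  ContMDiffAt (𝓡 n) (𝓡 n).tangent ∞ (fun y => (⟨y, X y⟩ : TangentBundle (𝓡 n) M)) p

/-- Differentiability at `p` of a vector field. -/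
abbrev DiffAt (X : (y : M) → TangentSpace (𝓡 n) y) (p : M) : Prop :=
  MDifferentiableAt (𝓡 n) (𝓡 n).tangent (fun y => (⟨y, X y⟩ : TangentBundle (𝓡 n) M)) p

variable {X Y Y' Z : (y : M) → TangentSpace (𝓡 n) y} {p : M} {f : M → ℝ}

lemma SmoothAt.diffAt (h : SmoothAt X p) : DiffAt X p := h.mdifferentiableAt (by simp)

lemma SmoothAt.eventually_diffAt (h : SmoothAt X p) : ∀ᶠ y in 𝓝 p, DiffAt X y := by
  have h1 : ContMDiffAt (𝓡 n) (𝓡 n).tangent 1 (fun y => (⟨y, X y⟩ : TangentBundle (𝓡 n) M)) p :=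
    h.of_le (by simp)
  filter_upwards [(contMDiffAt_iff_contMDiffAt_nhds (by simp)).1 h1] with y hy using ContMDiffAt.mdifferentiableAt hy one_ne_zero

lemma smoothAt_ext (u : TangentSpace (𝓡 n) p) : SmoothAt (ext u) p :=
  FiberBundle.contMDiffAt_extend _ _ u

@[simp] lemma ext_self (u : TangentSpace (𝓡 n) p) : ext u p = u := FiberBundle.extend_apply_self _ u

scoped instance isManifold_minSmoothness_two : IsManifold (𝓡 n) (minSmoothness ℝ 2) M :=
  IsManifold.of_le (n := ∞) (by rw [minSmoothness_of_isRCLikeNormedField]; exact WithTop.coe_le_coe.2 (le_top : (2 : ℕ∞) ≤ ⊤))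

scoped instance isManifold_minSmoothness_three : IsManifold (𝓡 n) (minSmoothness ℝ 3) M :=
  IsManifold.of_le (n := ∞) (by rw [minSmoothness_of_isRCLikeNormedField]; exact WithTop.coe_le_coe.2 (le_top : (3 : ℕ∞) ≤ ⊤))

lemma SmoothAt.mlieBracket (hX : SmoothAt X p) (hY : SmoothAt Y p) :
    SmoothAt (VectorField.mlieBracket (𝓡 n) X Y) p := by
  have : IsManifold (𝓡 n) (((⊤ : ℕ∞) : WithTop ℕ∞) + 1) M := inferInstanceAs (IsManifold (𝓡 n) ∞ M)
  exact ContMDiffAt.mlieBracket_vectorField (m := ⊤) (n := ⊤) hX hY (by simp)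

lemma SmoothAt.congr (hX : SmoothAt X p) (h : ∀ᶠ y in 𝓝 p, Y y = X y) : SmoothAt Y p := by
  refine ContMDiffAt.congr_of_eventuallyEq hX ?_
  filter_upwards [h] with y hy
  simp [hy]

lemma contMDiffAt_mvfderiv_apply {f : M → ℝ} (hf : ContMDiffAt (𝓡 n) 𝓘(ℝ) ∞ f p) (hX : SmoothAt X p) :
    ContMDiffAt (𝓡 n) 𝓘(ℝ) ∞ (fun y => mvfderiv (𝓡 n) f y (X y)) p := by
  have h1 := ContMDiffAt.mfderiv_const (m := ∞) hf (by simp)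
  have := ContMDiffAt.clm_apply_of_inCoordinates (F₁ := EuclideanSpace ℝ (Fin n)) (F₂ := ℝ)
    (E₁ := fun p : M => TangentSpace (𝓡 n) p) (E₂ := fun x : ℝ => TangentSpace 𝓘(ℝ) x) (b₁ := id) (b₂ := f) (v := X)
    (ϕ := fun y => mfderiv (𝓡 n) 𝓘(ℝ) f y) h1 hX hf
  rw [contMDiffAt_totalSpace] at this
  have h2 := this.2
  simp at h2
  exact h2

lemma DiffAt.smul (hf : MDifferentiableAt (𝓡 n) 𝓘(ℝ) f p) (hX : DiffAt X p) : DiffAt (f • X) p :=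
  hf.smul_section hX

lemma DiffAt.add (hX : DiffAt X p) (hY : DiffAt Y p) : DiffAt (X + Y) p :=
  mdifferentiableAt_add_section hX hY

lemma mvfderiv_congr {f g : M → ℝ} (h : ∀ᶠ y in 𝓝 p, f y = g y) :
    mvfderiv (𝓡 n) f p = mvfderiv (𝓡 n) g p := by
  have h1 : f =ᶠ[𝓝 p] g := h
  ext u
  simp only [mvfderiv, ContinuousLinearMap.comp_apply, h1.mfderiv_eq]
  rfl

lemma mlieBracket_congr_right (h : ∀ᶠ y in 𝓝 p, Y y = Y' y) :
    VectorField.mlieBracket (𝓡 n) X Y p = VectorField.mlieBracket (𝓡 n) X Y' p :=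
  Filter.EventuallyEq.mlieBracket_vectorField_eq (Filter.EventuallyEq.refl _ X) h

lemma mlieBracket_congr_left (h : ∀ᶠ y in 𝓝 p, Y y = Y' y) :
    VectorField.mlieBracket (𝓡 n) Y X p = VectorField.mlieBracket (𝓡 n) Y' X p :=
  Filter.EventuallyEq.mlieBracket_vectorField_eq h (Filter.EventuallyEq.refl _ X)

lemma finrank_tangentSpace (p : M) : finrank ℝ (TangentSpace (𝓡 n) p) = n :=
  (finrank_euclideanSpace_fin : finrank ℝ (EuclideanSpace ℝ (Fin n)) = n)

lemma SmoothAt.smul (hX : SmoothAt X p) (hf : ContMDiffAt (𝓡 n) 𝓘(ℝ) ∞ f p) : SmoothAt (f • X) p :=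
  ContMDiffAt.smul_section hf hX

lemma SmoothAt.add (hX : SmoothAt X p) (hY : SmoothAt Y p) : SmoothAt (X + Y) p :=
  ContMDiffAt.add_section hX hY

lemma jacobi_mlieBracket (hX : SmoothAt X p) (hY : SmoothAt Y p) (hZ : SmoothAt Z p) :
    VectorField.mlieBracket (𝓡 n) X (VectorField.mlieBracket (𝓡 n) Y Z) p
    + VectorField.mlieBracket (𝓡 n) Y (VectorField.mlieBracket (𝓡 n) Z X) p
    + VectorField.mlieBracket (𝓡 n) Z (VectorField.mlieBracket (𝓡 n) X Y) p = 0 := by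
  have h2 : ∀ {U : (y : M) → TangentSpace (𝓡 n) y}, SmoothAt U p →
      ContMDiffAt (𝓡 n) (𝓡 n).tangent (minSmoothness ℝ 2)
      (fun y => (⟨y, U y⟩ : TangentBundle (𝓡 n) M)) p := fun hU => hU.of_le
      (by rw [minSmoothness_of_isRCLikeNormedField]; exact WithTop.coe_le_coe.2 (le_top : (2 : ℕ∞) ≤ ⊤))
  -- The minus sign is written as a constant function so that the Leibniz rule for brackets can pull
  -- it out of the outer bracket.
  have e : VectorField.mlieBracket (𝓡 n) Z X = (fun _ : M => (-1 : ℝ)) • VectorField.mlieBracket (𝓡 n) X Z := by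
    funext y
    simp [VectorField.mlieBracket_swap_apply (V := Z) (W := X)]
  rw [VectorField.leibniz_identity_mlieBracket_apply (h2 hX) (h2 hY) (h2 hZ), e,
    VectorField.mlieBracket_smul_right mdifferentiableAt_const (hX.mlieBracket hZ).diffAt,
    VectorField.mlieBracket_swap_apply (V := Z), mvfderiv_const]
  simp

/-- A function with vanishing derivative on a connected manifold is constant. -/
lemma eq_of_mvfderiv_eq_zero [PreconnectedSpace M]
    (hf : ∀ p, MDifferentiableAt (𝓡 n) 𝓘(ℝ) f p) (h0 : ∀ p, mvfderiv (𝓡 n) f p = 0) (p q : M) :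
    f p = f q := by
  refine IsLocallyConstant.apply_eq_of_preconnectedSpace ?_ p q
  rw [IsLocallyConstant.iff_eventually_eq]
  intro x
  let φ := extChartAt (𝓡 n) x
  obtain ⟨r, hr, hb⟩ := Metric.isOpen_iff.1 (isOpen_extChartAt_target (I := 𝓡 n) x) _
    (mem_extChartAt_target (I := 𝓡 n) x)
  have hd : ∀ e ∈ Metric.ball (φ x) r, HasFDerivAt (f ∘ φ.symm) (0 : EuclideanSpace ℝ (Fin n) →L[ℝ] ℝ) e := by
    intro e he
    have hs : MDifferentiableAt 𝓘(ℝ, EuclideanSpace ℝ (Fin n)) (𝓡 n) φ.symm e :=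
      ((contMDiffOn_extChartAt_symm (n := ∞) x).contMDiffAt
        ((isOpen_extChartAt_target x).mem_nhds (hb he))).mdifferentiableAt (by simp)
    have h1 : mfderiv (𝓡 n) 𝓘(ℝ) f (φ.symm e) = 0 := h0 _
    have h2 := (hf (φ.symm e)).hasMFDerivAt.comp e hs.hasMFDerivAt
    rw [h1, ContinuousLinearMap.zero_comp] at h2
    exact h2.hasFDerivAt
  have hc : ∀ e ∈ Metric.ball (φ x) r, f (φ.symm e) = f (φ.symm (φ x)) := fun e he =>
    Metric.isOpen_ball.is_const_of_fderiv_eq_zero (convex_ball _ _).isPreconnected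
      (fun e he => (hd e he).differentiableAt.differentiableWithinAt)
      (fun e he => (hd e he).fderiv) he (Metric.mem_ball_self hr)
  filter_upwards [(continuousAt_extChartAt (I := 𝓡 n) x).preimage_mem_nhds (Metric.ball_mem_nhds _ hr),
    extChartAt_source_mem_nhds (I := 𝓡 n) x] with y hy hys
  have := hc _ hy
  rwa [φ.left_inv hys, φ.left_inv (mem_extChartAt_source x)] at this

end

/-! ### The Koszul formula -/

section

variable {n : ℕ} {M : Type*} [TopologicalSpace M] [ChartedSpace (EuclideanSpace ℝ (Fin n)) M]
  [IsManifold (𝓡 n) ∞ M] [RiemannianBundle (fun p : M => TangentSpace (𝓡 n) p)]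
  [IsContMDiffRiemannianBundle (𝓡 n) ∞ (EuclideanSpace ℝ (Fin n))
      (fun p : M => TangentSpace (𝓡 n) p)]
  {X X' Y Y' Z Z' : (y : M) → TangentSpace (𝓡 n) y} {p : M} {f : M → ℝ}

lemma SmoothAt.inner (hX : SmoothAt X p) (hY : SmoothAt Y p) :
    ContMDiffAt (𝓡 n) 𝓘(ℝ) ∞ (fun y => ⟪X y, Y y⟫) p :=
  ContMDiffAt.inner_bundle (n := ∞) hX hY

lemma DiffAt.inner (hX : DiffAt X p) (hY : DiffAt Y p) :
    MDifferentiableAt (𝓡 n) 𝓘(ℝ) (fun y => ⟪X y, Y y⟫) p :=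
  have : IsContMDiffRiemannianBundle (𝓡 n) 1 (EuclideanSpace ℝ (Fin n))
      (fun p : M => TangentSpace (𝓡 n) p) := .of_le (n := ∞) (by simp)
  MDifferentiableAt.inner_bundle hX hY

lemma koszul_add_right (hX : DiffAt X p) (hY : DiffAt Y p) (hZ : DiffAt Z p) (hZ' : DiffAt Z' p) :
    koszul X Y (Z + Z') p = koszul X Y Z p + koszul X Y Z' p := by
  simp only [koszul, Pi.add_apply, inner_add_left, inner_add_right, map_add,
    mvfderiv_fun_add (hY.inner hZ) (hY.inner hZ'), mvfderiv_fun_add (hZ.inner hX) (hZ'.inner hX),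
    VectorField.mlieBracket_add_left hZ hZ', VectorField.mlieBracket_add_right hZ hZ',
    add_apply]
  ring

lemma koszul_smul_right (hf : MDifferentiableAt (𝓡 n) 𝓘(ℝ) f p) (hX : DiffAt X p) (hY : DiffAt Y p)
    (hZ : DiffAt Z p) :
    koszul X Y (f • Z) p = f p * koszul X Y Z p := by
  simp only [koszul, Pi.smul_apply', inner_smul_left, inner_smul_right, map_smul,
    mvfderiv_fun_mul hf (hY.inner hZ), mvfderiv_fun_mul hf (hZ.inner hX), conj_trivial,
    VectorField.mlieBracket_smul_left hf hZ, VectorField.mlieBracket_smul_right hf hZ,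
    add_apply, smul_apply, smul_eq_mul, inner_add_left, neg_mul]
  rw [real_inner_comm (X p) (Z p), real_inner_comm (Y p) (Z p)]
  ring

lemma koszul_add_left (hX : DiffAt X p) (hX' : DiffAt X' p) (hY : DiffAt Y p) (hZ : DiffAt Z p) :
    koszul (X + X') Y Z p = koszul X Y Z p + koszul X' Y Z p := by
  simp only [koszul, Pi.add_apply, inner_add_left, inner_add_right, map_add,
    mvfderiv_fun_add (hX.inner hY) (hX'.inner hY), mvfderiv_fun_add (hZ.inner hX) (hZ.inner hX'),
    VectorField.mlieBracket_add_left hX hX', VectorField.mlieBracket_add_right hX hX',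
    add_apply]
  ring

lemma koszul_smul_left (hf : MDifferentiableAt (𝓡 n) 𝓘(ℝ) f p) (hX : DiffAt X p) (hY : DiffAt Y p)
    (hZ : DiffAt Z p) :
    koszul (f • X) Y Z p = f p * koszul X Y Z p := by
  simp only [koszul, Pi.smul_apply', inner_smul_left, inner_smul_right, map_smul,
    mvfderiv_fun_mul hf (hX.inner hY), mvfderiv_fun_mul hf (hZ.inner hX), conj_trivial,
    VectorField.mlieBracket_smul_left hf hX, VectorField.mlieBracket_smul_right hf hX,
    add_apply, smul_apply, smul_eq_mul, inner_add_left, neg_mul]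
  rw [real_inner_comm (X p) (Z p), real_inner_comm (Y p) (X p)]
  ring

lemma koszul_add_mid (hX : DiffAt X p) (hY : DiffAt Y p) (hY' : DiffAt Y' p) (hZ : DiffAt Z p) :
    koszul X (Y + Y') Z p = koszul X Y Z p + koszul X Y' Z p := by
  simp only [koszul, Pi.add_apply, inner_add_left, inner_add_right, map_add,
    mvfderiv_fun_add (hX.inner hY) (hX.inner hY'), mvfderiv_fun_add (hY.inner hZ) (hY'.inner hZ),
    VectorField.mlieBracket_add_left hY hY', VectorField.mlieBracket_add_right hY hY',
    add_apply]
  ring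

lemma koszul_smul_mid (hf : MDifferentiableAt (𝓡 n) 𝓘(ℝ) f p) (hX : DiffAt X p) (hY : DiffAt Y p)
    (hZ : DiffAt Z p) :
    koszul X (f • Y) Z p = f p * koszul X Y Z p + mvfderiv (𝓡 n) f p (X p) * ⟪Y p, Z p⟫ := by
  simp only [koszul, Pi.smul_apply', inner_smul_left, inner_smul_right, map_smul,
    mvfderiv_fun_mul hf (hX.inner hY), mvfderiv_fun_mul hf (hY.inner hZ), conj_trivial,
    VectorField.mlieBracket_smul_left hf hY, VectorField.mlieBracket_smul_right hf hY,
    add_apply, smul_apply, smul_eq_mul, inner_add_left, neg_mul]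
  rw [real_inner_comm (Y p) (X p)]
  ring

/-- In the difference all derivative terms cancel and only one bracket survives: this is torsion
freeness. -/
lemma koszul_swap (X Y Z : (y : M) → TangentSpace (𝓡 n) y) (p : M) :
    koszul X Y Z p - koszul Y X Z p = ⟪VectorField.mlieBracket (𝓡 n) X Y p, Z p⟫ := by
  simp only [koszul]
  simp only [VectorField.mlieBracket_swap_apply (V := Y) (W := X),
    VectorField.mlieBracket_swap_apply (V := X) (W := Z),
    VectorField.mlieBracket_swap_apply (V := Z) (W := Y), inner_neg_left]
  simp only [fun y => real_inner_comm (X y) (Y y), fun y => real_inner_comm (X y) (Z y),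
    fun y => real_inner_comm (Y y) (Z y)]
  ring

/-- In the sum all brackets cancel and only one derivative survives: this is compatibility with the
metric. -/
lemma koszul_add_koszul (X Y Z : (y : M) → TangentSpace (𝓡 n) y) (p : M) :
    koszul X Y Z p + koszul X Z Y p = mvfderiv (𝓡 n) (fun y => ⟪Y y, Z y⟫) p (X p) := by
  simp only [koszul]
  simp only [VectorField.mlieBracket_swap_apply (V := Y) (W := X),
    VectorField.mlieBracket_swap_apply (V := X) (W := Z),
    VectorField.mlieBracket_swap_apply (V := Z) (W := Y), inner_neg_left]
  simp only [fun y => real_inner_comm (X y) (Y y), fun y => real_inner_comm (X y) (Z y),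
    fun y => real_inner_comm (Y y) (Z y)]
  ring

/-- The Koszul expression is tensorial in its first and third slots; in the middle slot it is a
derivation. -/
lemma koszul_congr (hX : DiffAt X p) (hX' : DiffAt X' p) (hY : DiffAt Y p) (hZ : DiffAt Z p)
    (hZ' : DiffAt Z' p) (h : X p = X' p) (h' : Z p = Z' p) :
    koszul X Y Z p = koszul X' Y Z' p := by
  have h1 : TensorialAt (𝓡 n) (EuclideanSpace ℝ (Fin n)) (fun W => koszul W Y Z p) p :=
    ⟨fun hf hW => koszul_smul_left hf hW hY hZ, fun hW hW' => koszul_add_left hW hW' hY hZ⟩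
  have h2 : TensorialAt (𝓡 n) (EuclideanSpace ℝ (Fin n)) (fun W => koszul X' Y W p) p :=
    ⟨fun hf hW => koszul_smul_right hf hX' hY hW, fun hW hW' => koszul_add_right hX' hY hW hW'⟩
  exact (h1.pointwise hX hX' h).trans (h2.pointwise hZ hZ' h')

/-- `nabla` is defined through one frame and the fields `ext`; tensoriality of the Koszul expression
in the outer slots extends the formula to all differentiable fields. -/
lemma inner_nabla (hX : DiffAt X p) (hY : DiffAt Y p) (hZ : DiffAt Z p) :
    ⟪nabla Y p (X p), Z p⟫ = koszul X Y Z p := by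
  have h2 : TensorialAt (𝓡 n) (EuclideanSpace ℝ (Fin n)) (fun W => koszul X Y W p) p :=
    ⟨fun hf hW => koszul_smul_right hf hX hY hW, fun hW hW' => koszul_add_right hX hY hW hW'⟩
  have key : ∀ w : TangentSpace (𝓡 n) p, koszul X Y (ext w) p = h2.mkHom _ _ w := fun w => rfl
  have hZp : koszul X Y Z p = ∑ i, ⟪frame p i, Z p⟫ * koszul X Y (ext (frame p i)) p := by
    rw [← koszul_congr hX hX hY (smoothAt_ext (Z p)).diffAt hZ rfl (ext_self _), key]
    conv_lhs => rw [← (frame p).sum_repr' (Z p), map_sum]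
    simp only [map_smul, key, smul_eq_mul]
  rw [hZp, nabla, sum_inner]
  refine Finset.sum_congr rfl fun i _ => ?_
  rw [inner_smul_left, conj_trivial, mul_comm, koszul_congr (smoothAt_ext (X p)).diffAt hX hY
    (smoothAt_ext _).diffAt (smoothAt_ext _).diffAt (ext_self _) rfl]

/-! ### The Levi-Civita connection -/

lemma nabla_add_apply (hY : DiffAt Y p) (u v : TangentSpace (𝓡 n) p) :
    nabla Y p (u + v) = nabla Y p u + nabla Y p v := by
  refine ext_inner_right ℝ fun w => ?_
  have hu := (smoothAt_ext u).diffAt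
  have hv := (smoothAt_ext v).diffAt
  have hw := (smoothAt_ext w).diffAt
  have h1 := inner_nabla (hu.add hv) hY hw
  have h2 := inner_nabla hu hY hw
  have h3 := inner_nabla hv hY hw
  rw [koszul_add_left hu hv hY hw] at h1
  simp only [Pi.add_apply, ext_self] at h1 h2 h3
  rw [inner_add_left, h1, h2, h3]

lemma nabla_smul_apply (hY : DiffAt Y p) (c : ℝ) (u : TangentSpace (𝓡 n) p) :
    nabla Y p (c • u) = c • nabla Y p u := by
  refine ext_inner_right ℝ fun w => ?_
  have hu := (smoothAt_ext u).diffAt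
  have hw := (smoothAt_ext w).diffAt
  have hc : MDifferentiableAt (𝓡 n) 𝓘(ℝ) (fun _ : M => c) p := mdifferentiableAt_const
  have h1 := inner_nabla (hu.smul hc) hY hw
  have h2 := inner_nabla hu hY hw
  rw [koszul_smul_left hc hu hY hw] at h1
  simp only [Pi.smul_apply', ext_self] at h1 h2
  rw [inner_smul_left, h1, h2, conj_trivial]

lemma nabla_neg_apply (hY : DiffAt Y p) (u : TangentSpace (𝓡 n) p) :
    nabla Y p (-u) = -nabla Y p u := by
  rw [← neg_one_smul ℝ u, nabla_smul_apply hY, neg_one_smul]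

lemma nabla_add (hY : DiffAt Y p) (hY' : DiffAt Y' p) (u : TangentSpace (𝓡 n) p) :
    nabla (Y + Y') p u = nabla Y p u + nabla Y' p u := by
  refine ext_inner_right ℝ fun w => ?_
  have hu := (smoothAt_ext u).diffAt
  have hw := (smoothAt_ext w).diffAt
  have h1 := inner_nabla hu (hY.add hY') hw
  have h2 := inner_nabla hu hY hw
  have h3 := inner_nabla hu hY' hw
  rw [koszul_add_mid hu hY hY' hw] at h1
  simp only [ext_self] at h1 h2 h3
  rw [inner_add_left, h1, h2, h3]

/-- The Leibniz rule. -/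
lemma nabla_smul (hf : MDifferentiableAt (𝓡 n) 𝓘(ℝ) f p) (hY : DiffAt Y p)
    (u : TangentSpace (𝓡 n) p) :
    nabla (f • Y) p u = f p • nabla Y p u + mvfderiv (𝓡 n) f p u • Y p := by
  refine ext_inner_right ℝ fun w => ?_
  have hu := (smoothAt_ext u).diffAt
  have hw := (smoothAt_ext w).diffAt
  have h1 := inner_nabla hu (hY.smul hf) hw
  have h2 := inner_nabla hu hY hw
  rw [koszul_smul_mid hf hu hY hw] at h1
  simp only [ext_self] at h1 h2
  rw [inner_add_left, inner_smul_left, inner_smul_left, h1, h2, conj_trivial, conj_trivial]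

/-- The Levi-Civita connection is torsion free. -/
lemma nabla_sub_nabla (hX : DiffAt X p) (hY : DiffAt Y p) :
    nabla Y p (X p) - nabla X p (Y p) = VectorField.mlieBracket (𝓡 n) X Y p := by
  refine ext_inner_right ℝ fun w => ?_
  have hw := (smoothAt_ext w).diffAt
  have h1 := inner_nabla hX hY hw
  have h2 := inner_nabla hY hX hw
  have h3 := koszul_swap X Y (ext w) p
  simp only [ext_self] at h1 h2 h3
  rw [inner_sub_left, h1, h2, h3]

/-- The Levi-Civita connection is metric. -/
lemma mvfderiv_inner (hY : DiffAt Y p) (hZ : DiffAt Z p) (u : TangentSpace (𝓡 n) p) :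
    mvfderiv (𝓡 n) (fun y => ⟪Y y, Z y⟫) p u = ⟪nabla Y p u, Z p⟫ + ⟪Y p, nabla Z p u⟫ := by
  have hu := (smoothAt_ext u).diffAt
  have h1 := inner_nabla hu hY hZ
  have h2 := inner_nabla hu hZ hY
  have h3 := koszul_add_koszul (ext u) Y Z p
  simp only [ext_self] at h1 h2 h3
  rw [← h3, ← h1, ← h2, real_inner_comm (Y p)]

lemma nabla_congr (h : ∀ᶠ y in 𝓝 p, Y y = Y' y) (u : TangentSpace (𝓡 n) p) :
    nabla Y p u = nabla Y' p u := by
  refine Finset.sum_congr rfl fun i _ => ?_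
  have h2 : mvfderiv (𝓡 n) (fun y => ⟪Y y, ext (frame p i) y⟫) p =
      mvfderiv (𝓡 n) (fun y => ⟪Y' y, ext (frame p i) y⟫) p :=
    mvfderiv_congr (h.mono fun y hy => by rw [hy])
  have h3 : mvfderiv (𝓡 n) (fun y => ⟪ext u y, Y y⟫) p =
      mvfderiv (𝓡 n) (fun y => ⟪ext u y, Y' y⟫) p :=
    mvfderiv_congr (h.mono fun y hy => by rw [hy])
  rw [koszul, koszul, h2, h3, h.self_of_nhds,
    mlieBracket_congr_left h, mlieBracket_congr_right h]

/-- Directional derivatives along a Lie bracket are commutators. -/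
lemma mvfderiv_mlieBracket (hf : ContMDiffAt (𝓡 n) 𝓘(ℝ) ∞ f p) (hX : SmoothAt X p)
    (hY : SmoothAt Y p) :
    mvfderiv (𝓡 n) f p (VectorField.mlieBracket (𝓡 n) X Y p) =
      mvfderiv (𝓡 n) (fun y => mvfderiv (𝓡 n) f y (Y y)) p (X p) -
      mvfderiv (𝓡 n) (fun y => mvfderiv (𝓡 n) f y (X y)) p (Y p) := by
  by_cases hp : Subsingleton (TangentSpace (𝓡 n) p)
  · simp [Subsingleton.elim (VectorField.mlieBracket (𝓡 n) X Y p) 0, Subsingleton.elim (X p) 0,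
      Subsingleton.elim (Y p) 0]
  rw [not_subsingleton_iff_nontrivial] at hp
  -- The Jacobi identity for X, Y, fZ minus f times that for X, Y, Z leaves ([X,Y]f - XYf + YXf) Z =
  -- 0. Taking Z with nonzero value w at p gives the claim.
  obtain ⟨w, hw⟩ := exists_ne (0 : TangentSpace (𝓡 n) p)
  have hZ := smoothAt_ext w
  have hfd := hf.mdifferentiableAt (by simp)
  have hfe : ∀ᶠ y in 𝓝 p, MDifferentiableAt (𝓡 n) 𝓘(ℝ) f y := by
    filter_upwards [(contMDiffAt_iff_contMDiffAt_nhds (by simp)).1 (hf.of_le (m := 1) (by simp))]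
      with y hy using ContMDiffAt.mdifferentiableAt hy one_ne_zero
  have expand : ∀ {U : (y : M) → TangentSpace (𝓡 n) y},
      VectorField.mlieBracket (𝓡 n) U (f • ext w) =ᶠ[𝓝 p]
      (fun y => mvfderiv (𝓡 n) f y (U y)) • ext w + f • VectorField.mlieBracket (𝓡 n) U (ext w) := by
    intro U
    filter_upwards [hfe, hZ.eventually_diffAt] with y hy hy'
    exact VectorField.mlieBracket_smul_right hy hy'
  have outer : ∀ {U V : (y : M) → TangentSpace (𝓡 n) y}, SmoothAt U p → SmoothAt V p →
      VectorField.mlieBracket (𝓡 n) V (VectorField.mlieBracket (𝓡 n) U (f • ext w)) p =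
      (mvfderiv (𝓡 n) (fun y => mvfderiv (𝓡 n) f y (U y)) p (V p) • w
        + mvfderiv (𝓡 n) f p (U p) • VectorField.mlieBracket (𝓡 n) V (ext w) p)
      + (mvfderiv (𝓡 n) f p (V p) • VectorField.mlieBracket (𝓡 n) U (ext w) p
        + f p • VectorField.mlieBracket (𝓡 n) V (VectorField.mlieBracket (𝓡 n) U (ext w)) p) := by
    intro U V hU hV
    have hUf := (contMDiffAt_mvfderiv_apply hf hU).mdifferentiableAt (by simp)
    rw [mlieBracket_congr_right expand,
      VectorField.mlieBracket_add_right (hZ.diffAt.smul hUf)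
        ((hU.mlieBracket hZ).diffAt.smul hfd), VectorField.mlieBracket_smul_right hUf hZ.diffAt,
      VectorField.mlieBracket_smul_right hfd (hU.mlieBracket hZ).diffAt, ext_self]
  have h2 : ∀ {U : (y : M) → TangentSpace (𝓡 n) y}, SmoothAt U p →
      ContMDiffAt (𝓡 n) (𝓡 n).tangent (minSmoothness ℝ 2)
      (fun y => (⟨y, U y⟩ : TangentBundle (𝓡 n) M)) p := fun hU => hU.of_le
      (by rw [minSmoothness_of_isRCLikeNormedField]; exact WithTop.coe_le_coe.2 (le_top : (2 : ℕ∞) ≤ ⊤))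
  have hfZ : SmoothAt (f • ext w) p := ContMDiffAt.smul_section hf hZ
  have J1 := VectorField.leibniz_identity_mlieBracket_apply (h2 hX) (h2 hY) (h2 hZ)
  have J2 := VectorField.leibniz_identity_mlieBracket_apply (h2 hX) (h2 hY) (h2 hfZ)
  rw [outer hY hX, outer hX hY, expand.self_of_nhds, J1] at J2
  simp only [Pi.add_apply, Pi.smul_apply', ext_self] at J2
  have : (mvfderiv (𝓡 n) f p (VectorField.mlieBracket (𝓡 n) X Y p) -
      (mvfderiv (𝓡 n) (fun y => mvfderiv (𝓡 n) f y (Y y)) p (X p) -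
      mvfderiv (𝓡 n) (fun y => mvfderiv (𝓡 n) f y (X y)) p (Y p))) • w = 0 := by
    rw [← sub_eq_zero] at J2
    rw [← neg_eq_zero, ← J2]
    module
  exact sub_eq_zero.1 ((smul_eq_zero.1 this).resolve_right hw)

/-! ### Orthonormal frames -/

/-- An orthonormal family of the right cardinality, as an orthonormal basis. -/
def _root_.Orthonormal.toBasis {ι V : Type*} [Fintype ι] [NormedAddCommGroup V] [InnerProductSpace ℝ V]
    [FiniteDimensional ℝ V] {v : ι → V} (hv : Orthonormal ℝ v) (hc : Fintype.card ι = finrank ℝ V) :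
    OrthonormalBasis ι ℝ V :=
  OrthonormalBasis.mk hv (by
    rw [hv.linearIndependent.span_eq_top_of_card_eq_finrank' hc])

lemma _root_.Orthonormal.toBasis_apply {ι V : Type*} [Fintype ι] [NormedAddCommGroup V]
    [InnerProductSpace ℝ V] [FiniteDimensional ℝ V] {v : ι → V} (hv : Orthonormal ℝ v)
    (hc : Fintype.card ι = finrank ℝ V) (i : ι) : hv.toBasis hc i = v i := by
  simp [Orthonormal.toBasis]

/-- The unnormalized Gram-Schmidt recursion uses only inner products and division by squared norms,
which are nonzero at p by independence there. -/
lemma smoothAt_gramSchmidt {s : Fin n → (y : M) → TangentSpace (𝓡 n) y}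
    (hs : ∀ i, SmoothAt (s i) p) (hli : LinearIndependent ℝ fun i => s i p) (i : Fin n) :
    SmoothAt (fun y => InnerProductSpace.gramSchmidt ℝ (fun j => s j y) i) p := by
  induction i using WellFoundedLT.induction with
  | _ i ih =>
  have h : ∀ y, InnerProductSpace.gramSchmidt ℝ (fun j => s j y) i = s i y - ∑ j ∈ Finset.Iio i,
      (⟪InnerProductSpace.gramSchmidt ℝ (fun j => s j y) j, s i y⟫ /
        ⟪InnerProductSpace.gramSchmidt ℝ (fun j => s j y) j,
          InnerProductSpace.gramSchmidt ℝ (fun j => s j y) j⟫) •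
        InnerProductSpace.gramSchmidt ℝ (fun j => s j y) j := fun y => by
    rw [eq_sub_iff_add_eq]
    simp only [real_inner_self_eq_norm_sq]
    exact (InnerProductSpace.gramSchmidt_def'' ℝ (fun j => s j y) i).symm
  refine SmoothAt.congr (X := fun y => s i y - ∑ j ∈ Finset.Iio i, _) ?_ (Filter.Eventually.of_forall h)
  refine ContMDiffAt.sub_section (hs i) (ContMDiffAt.sum_section fun j hj => ?_)
  have hj := ih j (Finset.mem_Iio.1 hj)
  refine ContMDiffAt.smul_section (ContMDiffAt.div₀ (hj.inner (hs i)) (hj.inner hj) ?_) hj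
  rw [inner_self_ne_zero]
  exact InnerProductSpace.gramSchmidt_ne_zero _ hli

/-- Near every point there is a smooth orthonormal frame. -/
lemma exists_orthonormal_frame (p : M) : ∃ E : Fin n → (y : M) → TangentSpace (𝓡 n) y,
    ∀ᶠ y in 𝓝 p, (∀ i, SmoothAt (E i) y) ∧ Orthonormal ℝ fun i => E i y := by
  let t := trivializationAt (EuclideanSpace ℝ (Fin n)) (TangentSpace (𝓡 n) (M := M)) p
  let b := (EuclideanSpace.basisFun (Fin n) ℝ).toBasis
  have ht := t.isLocalFrameOn_localFrame_baseSet (𝓡 n) ∞ b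
  have hp : t.baseSet ∈ 𝓝 p := t.open_baseSet.mem_nhds (FiberBundle.mem_baseSet_trivializationAt' p)
  refine ⟨fun i y => InnerProductSpace.gramSchmidtNormed ℝ (fun j => t.localFrame b j y) i, ?_⟩
  filter_upwards [hp] with y hy
  have hli := ht.linearIndependent hy
  refine ⟨fun i => ?_, InnerProductSpace.gramSchmidtNormed_orthonormal hli⟩
  have hg := smoothAt_gramSchmidt (fun i => ht.contMDiffAt t.open_baseSet hy i) hli i
  have hne := InnerProductSpace.gramSchmidt_ne_zero i hli
  refine SmoothAt.congr (X := fun y => (√⟪InnerProductSpace.gramSchmidt ℝ (fun j => t.localFrame b j y) i,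
    InnerProductSpace.gramSchmidt ℝ (fun j => t.localFrame b j y) i⟫)⁻¹ •
    InnerProductSpace.gramSchmidt ℝ (fun j => t.localFrame b j y) i) ?_
    (Filter.Eventually.of_forall fun y => ?_)
  · refine ContMDiffAt.smul_section (ContMDiffAt.inv₀ ?_ ?_) hg
    · have hs := Real.contDiffAt_sqrt (n := ∞) (inner_self_ne_zero (𝕜 := ℝ).2 hne)
      exact ContDiffAt.comp_contMDiffAt (x := y) (f := fun z => ⟪InnerProductSpace.gramSchmidt ℝ
        (fun j => t.localFrame b j z) i, InnerProductSpace.gramSchmidt ℝ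
        (fun j => t.localFrame b j z) i⟫) hs (hg.inner hg)
    · rw [← norm_eq_sqrt_real_inner]
      exact norm_ne_zero_iff.2 hne
  · rw [← norm_eq_sqrt_real_inner]
    rfl

lemma contMDiffAt_koszul (hX : SmoothAt X p) (hY : SmoothAt Y p) (hZ : SmoothAt Z p) :
    ContMDiffAt (𝓡 n) 𝓘(ℝ) ∞ (koszul X Y Z) p := by
  refine contMDiffAt_const.mul (ContMDiffAt.add (ContMDiffAt.sub (ContMDiffAt.add (ContMDiffAt.sub
    (ContMDiffAt.add ?_ ?_) ?_) ?_) ?_) ?_)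
  · exact contMDiffAt_mvfderiv_apply (hY.inner hZ) hX
  · exact contMDiffAt_mvfderiv_apply (hZ.inner hX) hY
  · exact contMDiffAt_mvfderiv_apply (hX.inner hY) hZ
  · exact (hX.mlieBracket hY).inner hZ
  · exact (hY.mlieBracket hZ).inner hX
  · exact (hZ.mlieBracket hX).inner hY

/-- Smoothness of a vector field can be tested by inner products with smooth fields. -/
lemma smoothAt_of_inner (h : ∀ Z, SmoothAt Z p →
    ContMDiffAt (𝓡 n) 𝓘(ℝ) ∞ (fun y => ⟪X y, Z y⟫) p) : SmoothAt X p := by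
  obtain ⟨E, hE⟩ := exists_orthonormal_frame (n := n) p
  refine SmoothAt.congr (X := fun y => ∑ i, ⟪E i y, X y⟫ • E i y) ?_ ?_
  · refine ContMDiffAt.sum_section fun i _ => ?_
    exact ContMDiffAt.smul_section ((h _ (hE.self_of_nhds.1 i)).congr_of_eventuallyEq
      (Filter.Eventually.of_forall fun y => real_inner_comm _ _)) (hE.self_of_nhds.1 i)
  · filter_upwards [hE] with y hy
    have := (hy.2.toBasis (by simp [finrank_tangentSpace])).sum_repr' (X y)
    simp only [Orthonormal.toBasis_apply] at this
    exact this.symm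

lemma SmoothAt.nabla (hX : SmoothAt X p) (hY : SmoothAt Y p) :
    SmoothAt (fun y => nabla Y y (X y)) p := by
  refine smoothAt_of_inner fun Z hZ => (contMDiffAt_koszul hX hY hZ).congr_of_eventuallyEq ?_
  filter_upwards [hX.eventually_diffAt, hY.eventually_diffAt, hZ.eventually_diffAt] with y h1 h2 h3
  exact inner_nabla h1 h2 h3

/-! ### The curvature tensor -/

section Tensorial

variable {A : Type*} [AddCommGroup A] [Module ℝ A] {Φ : ((y : M) → TangentSpace (𝓡 n) y) → A}

/-- An operation on vector fields which is linear over functions smooth at `p` depends on the value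
of the field at `p` only. -/
lemma smooth_pointwise
    (hsmul : ∀ (f : M → ℝ) X, ContMDiffAt (𝓡 n) 𝓘(ℝ) ∞ f p → SmoothAt X p → Φ (f • X) = f p • Φ X)
    (hadd : ∀ X Y, SmoothAt X p → SmoothAt Y p → Φ (X + Y) = Φ X + Φ Y)
    (hX : SmoothAt X p) (hY : SmoothAt Y p) (h : X p = Y p) : Φ X = Φ Y := by
  classical
  have hloc : ∀ X Y, SmoothAt X p → SmoothAt Y p → (∀ᶠ y in 𝓝 p, X y = Y y) → Φ X = Φ Y := by
    intro X Y hX hY hXY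
    -- Smoothness is required at p only, so no bump function is needed: the indicator of the set
    -- where X = Y is 1 near p, and ψX = ψY holds on all of M.
    let ψ : M → ℝ := fun y => if X y = Y y then 1 else 0
    have hψp : ψ p = 1 := by simp [ψ, hXY.self_of_nhds]
    have hψ : ContMDiffAt (𝓡 n) 𝓘(ℝ) ∞ ψ p := by
      refine (contMDiffAt_const (c := (1 : ℝ))).congr_of_eventuallyEq ?_
      filter_upwards [hXY] with y hy
      simp [ψ, hy]
    have e : ψ • X = ψ • Y := by
      funext y
      by_cases hy : X y = Y y <;> simp [ψ, hy]
    have h1 := hsmul ψ X hψ hX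
    rw [e, hsmul ψ Y hψ hY, hψp, one_smul, one_smul] at h1
    exact h1.symm
  have hzero : SmoothAt (0 : (y : M) → TangentSpace (𝓡 n) y) p := by
    have := (smoothAt_ext (0 : TangentSpace (𝓡 n) p)).smul (f := fun _ => 0) contMDiffAt_const
    refine this.congr (Filter.Eventually.of_forall fun y => ?_)
    simp
  have hsum : ∀ (s : Finset (Fin n)) (F : Fin n → (y : M) → TangentSpace (𝓡 n) y),
      (∀ i, SmoothAt (F i) p) → SmoothAt (∑ i ∈ s, F i) p ∧ Φ (∑ i ∈ s, F i) = ∑ i ∈ s, Φ (F i) := by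
    intro s F hF
    induction s using Finset.induction_on with
    | empty =>
      refine ⟨by simpa using hzero, ?_⟩
      have := hsmul (fun _ => 0) 0 contMDiffAt_const hzero
      simpa using this
    | insert a s ha ih =>
      rw [Finset.sum_insert ha, Finset.sum_insert ha]
      exact ⟨(hF a).add ih.1, by rw [hadd _ _ (hF a) ih.1, ih.2]⟩
  obtain ⟨E, hE⟩ := exists_orthonormal_frame (n := n) p
  have hEp := hE.self_of_nhds.1
  have key : ∀ X, SmoothAt X p → Φ X = ∑ i, ⟪E i p, X p⟫ • Φ (E i) := by
    intro X hX
    -- X agrees near p with its expansion in the frame, whose coefficients are smooth at p.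
    have hs := hsum Finset.univ (fun i => (fun y => ⟪E i y, X y⟫) • E i)
      fun i => (hEp i).smul ((hEp i).inner hX)
    rw [hloc X _ hX hs.1, hs.2]
    · exact Finset.sum_congr rfl fun i _ => hsmul _ _ ((hEp i).inner hX) (hEp i)
    · filter_upwards [hE] with y hy
      have := (hy.2.toBasis (by simp [finrank_tangentSpace])).sum_repr' (X y)
      simp only [Orthonormal.toBasis_apply] at this
      simp [Finset.sum_apply, this]
  rw [key X hX, key Y hY, h]

end Tensorial

/-- The curvature operator applied to vector fields. -/
def curv (X Y Z : (y : M) → TangentSpace (𝓡 n) y) (p : M) : TangentSpace (𝓡 n) p :=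
  nabla (fun y => nabla Z y (Y y)) p (X p) - nabla (fun y => nabla Z y (X y)) p (Y p)
    - nabla Z p (VectorField.mlieBracket (𝓡 n) X Y p)

lemma curv_swap (hZ : SmoothAt Z p) : curv X Y Z p = -curv Y X Z p := by
  rw [curv, curv, VectorField.mlieBracket_swap_apply, nabla_neg_apply hZ.diffAt]
  abel

lemma curv_smul_left (hf : ContMDiffAt (𝓡 n) 𝓘(ℝ) ∞ f p) (hX : SmoothAt X p) (hY : SmoothAt Y p)
    (hZ : SmoothAt Z p) : curv (f • X) Y Z p = f p • curv X Y Z p := by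
  have hfd := hf.mdifferentiableAt (by simp)
  have e : ∀ᶠ y in 𝓝 p, nabla Z y ((f • X) y) = (f • fun y => nabla Z y (X y)) y := by
    filter_upwards [hZ.eventually_diffAt] with y hy using nabla_smul_apply hy _ _
  rw [curv, curv, nabla_congr e, nabla_smul hfd (hX.nabla hZ).diffAt, Pi.smul_apply',
    nabla_smul_apply (hY.nabla hZ).diffAt, VectorField.mlieBracket_smul_left hfd hX.diffAt,
    nabla_add_apply hZ.diffAt, nabla_smul_apply hZ.diffAt, nabla_smul_apply hZ.diffAt]
  module

lemma curv_add_left (hX : SmoothAt X p) (hX' : SmoothAt X' p) (hY : SmoothAt Y p)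
    (hZ : SmoothAt Z p) : curv (X + X') Y Z p = curv X Y Z p + curv X' Y Z p := by
  have e : ∀ᶠ y in 𝓝 p, nabla Z y ((X + X') y) =
      ((fun y => nabla Z y (X y)) + fun y => nabla Z y (X' y)) y := by
    filter_upwards [hZ.eventually_diffAt] with y hy using nabla_add_apply hy _ _
  rw [curv, curv, curv, nabla_congr e, nabla_add (hX.nabla hZ).diffAt (hX'.nabla hZ).diffAt,
    Pi.add_apply, nabla_add_apply (hY.nabla hZ).diffAt,
    VectorField.mlieBracket_add_left hX.diffAt hX'.diffAt, nabla_add_apply hZ.diffAt]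
  abel

lemma curv_add_right (hX : SmoothAt X p) (hY : SmoothAt Y p) (hZ : SmoothAt Z p)
    (hZ' : SmoothAt Z' p) : curv X Y (Z + Z') p = curv X Y Z p + curv X Y Z' p := by
  have e : ∀ U : (y : M) → TangentSpace (𝓡 n) y, ∀ᶠ y in 𝓝 p, nabla (Z + Z') y (U y) =
      ((fun y => nabla Z y (U y)) + fun y => nabla Z' y (U y)) y := by
    intro U
    filter_upwards [hZ.eventually_diffAt, hZ'.eventually_diffAt] with y hy hy'
      using nabla_add hy hy' _
  rw [curv, curv, curv, nabla_congr (e X), nabla_congr (e Y),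
    nabla_add (hX.nabla hZ).diffAt (hX.nabla hZ').diffAt,
    nabla_add (hY.nabla hZ).diffAt (hY.nabla hZ').diffAt, nabla_add hZ.diffAt hZ'.diffAt]
  abel

lemma curv_smul_right (hf : ContMDiffAt (𝓡 n) 𝓘(ℝ) ∞ f p) (hX : SmoothAt X p) (hY : SmoothAt Y p)
    (hZ : SmoothAt Z p) : curv X Y (f • Z) p = f p • curv X Y Z p := by
  have hfd := hf.mdifferentiableAt (by simp)
  have hfe : ∀ᶠ y in 𝓝 p, MDifferentiableAt (𝓡 n) 𝓘(ℝ) f y := by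
    filter_upwards [(contMDiffAt_iff_contMDiffAt_nhds (by simp)).1 (hf.of_le (m := 1) (by simp))]
      with y hy using ContMDiffAt.mdifferentiableAt hy one_ne_zero
  have e : ∀ U : (y : M) → TangentSpace (𝓡 n) y, ∀ᶠ y in 𝓝 p, nabla (f • Z) y (U y) =
      ((f • fun y => nabla Z y (U y)) + (fun y => mvfderiv (𝓡 n) f y (U y)) • Z) y := by
    intro U
    filter_upwards [hZ.eventually_diffAt, hfe] with y hy hy' using nabla_smul hy' hy _
  have d : ∀ U : (y : M) → TangentSpace (𝓡 n) y, SmoothAt U p →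
      MDifferentiableAt (𝓡 n) 𝓘(ℝ) (fun y => mvfderiv (𝓡 n) f y (U y)) p :=
    fun U hU => (contMDiffAt_mvfderiv_apply hf hU).mdifferentiableAt (by simp)
  rw [curv, curv, nabla_congr (e X), nabla_congr (e Y),
    nabla_add ((hX.nabla hZ).diffAt.smul hfd) (hZ.diffAt.smul (d X hX)),
    nabla_add ((hY.nabla hZ).diffAt.smul hfd) (hZ.diffAt.smul (d Y hY)),
    nabla_smul hfd (hX.nabla hZ).diffAt, nabla_smul hfd (hY.nabla hZ).diffAt,
    nabla_smul (d X hX) hZ.diffAt, nabla_smul (d Y hY) hZ.diffAt, nabla_smul hfd hZ.diffAt,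
    mvfderiv_mlieBracket hf hX hY]
  module

/-- Tensoriality in each slot: the fields `ext` in the definition may be replaced by any smooth
fields with the same values, in particular by a frame. The middle slot is reduced to the first by
antisymmetry. -/
lemma curvOp_apply (hX : SmoothAt X p) (hY : SmoothAt Y p) (hZ : SmoothAt Z p) :
    curvOp p (X p) (Y p) (Z p) = curv X Y Z p := by
  have hx := smoothAt_ext (X p)
  have hy := smoothAt_ext (Y p)
  have hz := smoothAt_ext (Z p)
  have h1 : curv (ext (X p)) (ext (Y p)) (ext (Z p)) p = curv X (ext (Y p)) (ext (Z p)) p :=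
    smooth_pointwise (Φ := fun W => curv W (ext (Y p)) (ext (Z p)) p)
      (fun f W hf hW => curv_smul_left hf hW hy hz) (fun W W' hW hW' => curv_add_left hW hW' hy hz)
      hx hX (ext_self _)
  have h2 : curv (ext (Y p)) X (ext (Z p)) p = curv Y X (ext (Z p)) p :=
    smooth_pointwise (Φ := fun W => curv W X (ext (Z p)) p)
      (fun f W hf hW => curv_smul_left hf hW hX hz) (fun W W' hW hW' => curv_add_left hW hW' hX hz)
      hy hY (ext_self _)
  have h3 : curv X Y (ext (Z p)) p = curv X Y Z p :=
    smooth_pointwise (Φ := fun W => curv X Y W p)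
      (fun f W hf hW => curv_smul_right hf hX hY hW)
      (fun W W' hW hW' => curv_add_right hX hY hW hW') hz hZ (ext_self _)
  rw [← h3, curv_swap hz, ← h2, ← curv_swap hz, ← h1, curv, ext_self, ext_self]
  rfl

lemma SmoothAt.curv (hX : SmoothAt X p) (hY : SmoothAt Y p) (hZ : SmoothAt Z p) :
    SmoothAt (curv X Y Z) p :=
  ((hX.nabla (hY.nabla hZ)).sub_section (hY.nabla (hX.nabla hZ))).sub_section
    ((hX.mlieBracket hY).nabla hZ)

/-- Differentiate ⟨Z,W⟩ twice and antisymmetrize: the terms with one derivative on each factor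
cancel, and the bracket acts on functions as a commutator. -/
lemma inner_curv_add_inner_curv {W : (y : M) → TangentSpace (𝓡 n) y} (hX : SmoothAt X p)
    (hY : SmoothAt Y p) (hZ : SmoothAt Z p) (hW : SmoothAt W p) :
    ⟪curv X Y Z p, W p⟫ + ⟪Z p, curv X Y W p⟫ = 0 := by
  have h1 : ∀ U V : (y : M) → TangentSpace (𝓡 n) y, SmoothAt U p → SmoothAt V p →
      mvfderiv (𝓡 n) (fun y => mvfderiv (𝓡 n) (fun y => ⟪Z y, W y⟫) y (V y)) p (U p) =
      ⟪nabla (fun y => nabla Z y (V y)) p (U p), W p⟫ + ⟪nabla Z p (V p), nabla W p (U p)⟫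
      + (⟪nabla Z p (U p), nabla W p (V p)⟫ + ⟪Z p, nabla (fun y => nabla W y (V y)) p (U p)⟫) := by
    intro U V hU hV
    have e : ∀ᶠ y in 𝓝 p, mvfderiv (𝓡 n) (fun y => ⟪Z y, W y⟫) y (V y) =
        ⟪nabla Z y (V y), W y⟫ + ⟪Z y, nabla W y (V y)⟫ := by
      filter_upwards [hZ.eventually_diffAt, hW.eventually_diffAt] with y hy hy'
        using mvfderiv_inner hy hy' _
    have dZ := (hV.nabla hZ).diffAt
    have dW := (hV.nabla hW).diffAt
    rw [mvfderiv_congr e, mvfderiv_fun_add (dZ.inner hW.diffAt) (hZ.diffAt.inner dW), add_apply,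
      mvfderiv_inner dZ hW.diffAt, mvfderiv_inner hZ.diffAt dW]
  have h2 := mvfderiv_mlieBracket (hZ.inner hW) hX hY
  rw [h1 X Y hX hY, h1 Y X hY hX, mvfderiv_inner hZ.diffAt hW.diffAt] at h2
  simp only [curv, inner_sub_left, inner_sub_right]
  linarith

/-- The first Bianchi identity. -/
lemma curv_cyclic (hX : SmoothAt X p) (hY : SmoothAt Y p) (hZ : SmoothAt Z p) :
    curv X Y Z p + curv Y Z X p + curv Z X Y p = 0 := by
  -- Torsion freeness is used twice, to exchange V with W and then U with [V,W]. In the cyclic sum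
  -- everything cancels except the Jacobi sum of brackets.
  have h : ∀ U V W : (y : M) → TangentSpace (𝓡 n) y, SmoothAt U p → SmoothAt V p → SmoothAt W p →
      nabla (fun y => nabla W y (V y)) p (U p) = nabla (fun y => nabla V y (W y)) p (U p)
      + nabla U p (VectorField.mlieBracket (𝓡 n) V W p)
      + VectorField.mlieBracket (𝓡 n) U (VectorField.mlieBracket (𝓡 n) V W) p := by
    intro U V W hU hV hW
    have e : ∀ᶠ y in 𝓝 p, nabla W y (V y) =
        ((fun y => nabla V y (W y)) + VectorField.mlieBracket (𝓡 n) V W) y := by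
      filter_upwards [hV.eventually_diffAt, hW.eventually_diffAt] with y hy hy'
      rw [Pi.add_apply, ← nabla_sub_nabla hy hy']
      abel
    rw [nabla_congr e, nabla_add (hW.nabla hV).diffAt (hV.mlieBracket hW).diffAt,
      ← nabla_sub_nabla hU.diffAt (hV.mlieBracket hW).diffAt]
    abel
  have J := jacobi_mlieBracket hX hY hZ
  rw [curv, curv, curv, h X Y Z hX hY hZ, h Y Z X hY hZ hX, h Z X Y hZ hX hY, ← J]
  abel

lemma nabla_sub (hY : DiffAt Y p) (hY' : DiffAt Y' p) (u : TangentSpace (𝓡 n) p) :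
    nabla (Y - Y') p u = nabla Y p u - nabla Y' p u := by
  rw [eq_sub_iff_add_eq, ← nabla_add (mdifferentiableAt_sub_section hY hY') hY', sub_add_cancel]

/-- The second Bianchi identity. -/
lemma nabla_curv_cyclic {W : (y : M) → TangentSpace (𝓡 n) y} (hX : SmoothAt X p)
    (hY : SmoothAt Y p) (hZ : SmoothAt Z p) (hW : SmoothAt W p) :
    (nabla (curv Y Z W) p (X p) - curv Y Z (fun y => nabla W y (X y)) p
      + curv X (VectorField.mlieBracket (𝓡 n) Y Z) W p)
    + (nabla (curv Z X W) p (Y p) - curv Z X (fun y => nabla W y (Y y)) p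
      + curv Y (VectorField.mlieBracket (𝓡 n) Z X) W p)
    + (nabla (curv X Y W) p (Z p) - curv X Y (fun y => nabla W y (Z y)) p
      + curv Z (VectorField.mlieBracket (𝓡 n) X Y) W p) = 0 := by
  have h : ∀ U V T : (y : M) → TangentSpace (𝓡 n) y, SmoothAt U p → SmoothAt V p → SmoothAt T p →
      nabla (curv V T W) p (U p) =
      nabla (fun y => nabla (fun y => nabla W y (T y)) y (V y)) p (U p)
      - nabla (fun y => nabla (fun y => nabla W y (V y)) y (T y)) p (U p)
      - nabla (fun y => nabla W y (VectorField.mlieBracket (𝓡 n) V T y)) p (U p) := by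
    intro U V T hU hV hT
    have h1 := hV.nabla (hT.nabla hW)
    have h2 := hT.nabla (hV.nabla hW)
    rw [← nabla_sub h1.diffAt h2.diffAt, ← nabla_sub (mdifferentiableAt_sub_section h1.diffAt h2.diffAt)
      ((hV.mlieBracket hT).nabla hW).diffAt]
    rfl
  -- With R(Y,Z) = [∇_Y,∇_Z] - ∇_[Y,Z], each summand is [∇_X,[∇_Y,∇_Z]] - ∇_[X,[Y,Z]] applied to W.
  -- The double commutators cancel cyclically; the rest is ∇W in the direction of the Jacobi sum.
  have J := jacobi_mlieBracket hX hY hZ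
  have J' := congrArg (nabla W p) J
  rw [nabla_add_apply hW.diffAt, nabla_add_apply hW.diffAt, ← zero_smul ℝ (0 : TangentSpace (𝓡 n) p),
    nabla_smul_apply hW.diffAt, zero_smul] at J'
  rw [h X Y Z hX hY hZ, h Y Z X hY hZ hX, h Z X Y hZ hX hY, ← neg_eq_zero, ← J']
  simp only [curv]
  abel

end

/-! ### Curvature operators in dimension three -/

section Algebra

variable {V : Type*} [NormedAddCommGroup V] [InnerProductSpace ℝ V]

/-- The metrical endomorphism `u ∧ v` of an inner product space. -/
def wedge (u v w : V) : V := ⟪v, w⟫ • u - ⟪u, w⟫ • v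

/-- Algebraic curvature operators. -/
structure IsAlgCurv (R : V → V → V → V) : Prop where
  add_left : ∀ u u' v w, R (u + u') v w = R u v w + R u' v w
  smul_left : ∀ (c : ℝ) u v w, R (c • u) v w = c • R u v w
  add_right : ∀ u v w w', R u v (w + w') = R u v w + R u v w'
  smul_right : ∀ (c : ℝ) u v w, R u v (c • w) = c • R u v w
  swap : ∀ u v w, R u v w = -R v u w
  skew : ∀ u v w z, ⟪R u v w, z⟫ + ⟪w, R u v z⟫ = 0
  cyclic : ∀ u v w, R u v w + R v w u + R w u v = 0

/-- An orthonormal frame of a three-dimensional inner product space. -/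
structure IsFrame (a b c : V) : Prop where
  aa : ⟪a, a⟫ = 1
  bb : ⟪b, b⟫ = 1
  cc : ⟪c, c⟫ = 1
  ab : ⟪a, b⟫ = 0
  ac : ⟪a, c⟫ = 0
  bc : ⟪b, c⟫ = 0
  expand : ∀ w, w = ⟪a, w⟫ • a + ⟪b, w⟫ • b + ⟪c, w⟫ • c

variable {R : V → V → V → V} {a b c ξ : V} {α β : ℝ}

namespace IsFrame

lemma rotate (h : IsFrame a b c) : IsFrame b c a :=
  ⟨h.bb, h.cc, h.aa, h.bc, by rw [real_inner_comm, h.ab], by rw [real_inner_comm, h.ac], fun w => by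
    conv_lhs => rw [h.expand w]
    abel⟩

lemma swap (h : IsFrame a b c) : IsFrame b a c :=
  ⟨h.bb, h.aa, h.cc, by rw [real_inner_comm, h.ab], h.bc, h.ac, fun w => by
    conv_lhs => rw [h.expand w]
    abel⟩

lemma of_basis (e : OrthonormalBasis (Fin 3) ℝ V) : IsFrame (e 0) (e 1) (e 2) := by
  refine ⟨by simp, by simp, by simp, by simp, by simp, by simp, fun w => ?_⟩
  conv_lhs => rw [← e.sum_repr' w, Fin.sum_univ_three]

lemma eq_of_inner (h : IsFrame a b c) {x y : V} (ha : ⟪a, x⟫ = ⟪a, y⟫) (hb : ⟪b, x⟫ = ⟪b, y⟫)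
    (hc : ⟪c, x⟫ = ⟪c, y⟫) : x = y := by
  rw [h.expand x, h.expand y, ha, hb, hc]

end IsFrame

/-- A skew operator preserving the plane of `a` and `b` is a multiple of `a ∧ b`. -/
lemma eq_smul_wedge (h : IsFrame a b c) {A : V → V} (hadd : ∀ u v, A (u + v) = A u + A v)
    (hsmul : ∀ (t : ℝ) u, A (t • u) = t • A u) (hskew : ∀ u v, ⟪A u, v⟫ + ⟪u, A v⟫ = 0)
    (hac : ⟪A a, c⟫ = 0) (hbc : ⟪A b, c⟫ = 0) (w : V) : A w = ⟪A b, a⟫ • wedge a b w := by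
  have haa := hskew a a
  have hbb := hskew b b
  have hcc := hskew c c
  have hab := hskew a b
  have hca := hskew a c
  have hcb := hskew b c
  rw [real_inner_comm] at haa hbb hcc
  have hA : A a = -(⟪A b, a⟫ • b) := by
    refine h.eq_of_inner ?_ ?_ ?_
    · rw [inner_neg_right, inner_smul_right, h.ab]; linarith
    · rw [inner_neg_right, inner_smul_right, h.bb, real_inner_comm, real_inner_comm a]
      linarith
    · rw [inner_neg_right, inner_smul_right, h.rotate.rotate.ac, real_inner_comm, hac]; ring
  have hB : A b = ⟪A b, a⟫ • a := by
    refine h.eq_of_inner ?_ ?_ ?_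
    · rw [inner_smul_right, h.aa, real_inner_comm]; ring
    · rw [inner_smul_right, h.swap.ab]; linarith
    · rw [inner_smul_right, h.rotate.rotate.ab, real_inner_comm, hbc]; ring
  have hC : A c = 0 := by
    refine h.eq_of_inner ?_ ?_ ?_
    · rw [inner_zero_right]; linarith
    · rw [inner_zero_right]; linarith
    · rw [inner_zero_right]; linarith
  generalize ⟪A b, a⟫ = k at hA hB
  conv_lhs => rw [h.expand w, hadd, hadd, hsmul, hsmul, hsmul, hA, hB, hC]
  rw [wedge]
  module

/-- The curvature operators of constant curvature `α` perturbed in direction `ξ` by `β`. -/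
def HasForm (R : V → V → V → V) (ξ : V) (α β : ℝ) : Prop :=
  ∀ u v w, R u v w = α • wedge u v w + β • (⟪ξ, u⟫ • wedge ξ v w + ⟪ξ, v⟫ • wedge u ξ w)

namespace IsAlgCurv

variable (hR : IsAlgCurv R)
include hR

lemma add_mid (u v v' w : V) : R u (v + v') w = R u v w + R u v' w := by
  rw [hR.swap, hR.add_left, hR.swap v, hR.swap v']; abel

lemma smul_mid (t : ℝ) (u v w : V) : R u (t • v) w = t • R u v w := by
  rw [hR.swap, hR.smul_left, hR.swap v]; simp

lemma self_left (u w : V) : R u u w = 0 := by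
  have h := hR.swap u u w
  rw [eq_neg_iff_add_eq_zero, ← two_smul ℝ] at h
  simpa using h

lemma skew' (u v w z : V) : ⟪R u v w, z⟫ = -⟪R u v z, w⟫ := by
  rw [eq_neg_iff_add_eq_zero, real_inner_comm w, hR.skew]

lemma swap' (u v w z : V) : ⟪R u v w, z⟫ = -⟪R v u w, z⟫ := by
  rw [hR.swap, inner_neg_left]

/-- The octahedron argument: add the first Bianchi identity over the four cyclic shifts of the
arguments and use both antisymmetries. -/
lemma pair_symm (u v w z : V) : ⟪R u v w, z⟫ = ⟪R w z u, v⟫ := by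
  have B : ∀ u v w z, ⟪R u v w, z⟫ + ⟪R v w u, z⟫ + ⟪R w u v, z⟫ = 0 := fun u v w z => by
    rw [← inner_add_left, ← inner_add_left, hR.cyclic, inner_zero_left]
  have h1 := B u v w z
  have h2 := B v w z u
  have h3 := B w z u v
  have h4 := B z u v w
  linarith [hR.skew' v w u z, hR.skew' w u v z, hR.skew' u v w z, hR.skew' w z u v, hR.skew' z u w v,
    hR.skew' z v u w, hR.swap' z u v w, hR.swap' w u v z, hR.swap' v z u w, hR.swap' v w u z,
    hR.skew' z v w u, hR.skew' z w v u, hR.swap' w z v u, hR.skew' u w z v, hR.swap' z v w u,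
    hR.skew' v z w u, hR.swap' u w z v, hR.skew' z u v w, hR.swap' u z w v, hR.skew' w z v u]

/-- A frame in which the curvature is diagonal. -/
lemma eq_smul_wedge_of_frame (h : IsFrame a b c) (hc : ⟪R a c c, b⟫ = 0) (hb : ⟪R a b b, c⟫ = 0)
    (ha : ⟪R b a a, c⟫ = 0) : (∀ w, R a b w = ⟪R a b b, a⟫ • wedge a b w) ∧
      (∀ w, R a c w = ⟪R a c c, a⟫ • wedge a c w) ∧ ∀ w, R b c w = ⟪R b c c, b⟫ • wedge b c w := by
  have ha' : ⟪R a b a, c⟫ = 0 := by rw [hR.swap', ha, neg_zero]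
  refine ⟨eq_smul_wedge h (hR.add_right a b) (fun t => hR.smul_right t a b) (hR.skew a b) ha' hb,
    eq_smul_wedge h.rotate.rotate.swap (hR.add_right a c) (fun t => hR.smul_right t a c)
    (hR.skew a c) ?_ hc, eq_smul_wedge h.rotate (hR.add_right b c) (fun t => hR.smul_right t b c)
    (hR.skew b c) ?_ ?_⟩
  · rw [hR.pair_symm, ha']
  · rw [hR.pair_symm, hR.swap', hb, neg_zero]
  · rw [hR.pair_symm, hR.skew', hR.swap', hc]; simp

/-- By bilinearity only the three frame planes matter: ξ = c, the plane orthogonal to c has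
curvature α = k, and the planes through c have curvature α + β = κ. -/
lemma hasForm_of_frame (h : IsFrame a b c) {k κ : ℝ} (hab : ∀ w, R a b w = k • wedge a b w)
    (hac : ∀ w, R a c w = κ • wedge a c w) (hbc : ∀ w, R b c w = κ • wedge b c w) :
    HasForm R c k (κ - k) := by
  intro u v w
  have hu := h.expand u
  have hv := h.expand v
  generalize hua : ⟪a, u⟫ = ua at hu
  generalize hub : ⟪b, u⟫ = ub at hu
  generalize huc : ⟪c, u⟫ = uc at hu
  generalize hva : ⟪a, v⟫ = va at hv
  generalize hvb : ⟪b, v⟫ = vb at hv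
  generalize hvc : ⟪c, v⟫ = vc at hv
  subst hu
  subst hv
  simp only [hR.add_left, hR.smul_left, hR.add_mid, hR.smul_mid, hR.self_left, hR.swap b a,
    hR.swap c a, hR.swap c b, hab, hac, hbc]
  simp only [wedge, inner_add_left, inner_smul_left, conj_trivial]
  module

end IsAlgCurv

/-- The tensor of this form satisfies the pseudo symmetry condition. -/
lemma HasForm.pseudo_symmetric (h : HasForm R ξ α β) (hξ : ⟪ξ, ξ⟫ = 1) (v₁ v₂ v₃ v₄ x y : V) :
    -⟪R (R x y v₁) v₂ v₃, v₄⟫ - ⟪R v₁ (R x y v₂) v₃, v₄⟫ - ⟪R v₁ v₂ (R x y v₃), v₄⟫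
      - ⟪R v₁ v₂ v₃, R x y v₄⟫ = (α + β) *
    (-⟪R (wedge x y v₁) v₂ v₃, v₄⟫ - ⟪R v₁ (wedge x y v₂) v₃, v₄⟫ - ⟪R v₁ v₂ (wedge x y v₃), v₄⟫
      - ⟪R v₁ v₂ v₃, wedge x y v₄⟫) := by
  unfold HasForm at h
  simp only [h, wedge, inner_add_left, inner_add_right, inner_sub_left, inner_sub_right,
    inner_smul_left, inner_smul_right, conj_trivial, hξ, real_inner_comm]
  ring

/-! ### Ricci eigenframes and the pseudo symmetry equation -/

lemma _root_.LinearMap.IsSymmetric.exists_eigenframe [FiniteDimensional ℝ V] {S : V →ₗ[ℝ] V}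
    (hS : S.IsSymmetric) (h3 : finrank ℝ V = 3) :
    ∃ e : OrthonormalBasis (Fin 3) ℝ V, ∃ k : Fin 3 → ℝ, ∀ i, S (e i) = k i • e i :=
  ⟨hS.eigenvectorBasis h3, hS.eigenvalues h3, fun i => hS.apply_eigenvectorBasis h3 i⟩

namespace IsAlgCurv

lemma ricci_symm (hR : IsAlgCurv R) (u v x : V) : ⟪R u x x, v⟫ = ⟪u, R v x x⟫ := by
  rw [hR.pair_symm, hR.swap', hR.skew', neg_neg, real_inner_comm]

/-- In dimension three the curvature is diagonal in an eigenframe of the Ricci operator. -/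
lemma exists_frame [FiniteDimensional ℝ V] (hR : IsAlgCurv R) (h3 : finrank ℝ V = 3) {S : V →ₗ[ℝ] V}
    (hS : ∀ (e : OrthonormalBasis (Fin 3) ℝ V) u, S u = ∑ t, R u (e t) (e t)) :
    ∃ (a b c : V) (x y z : ℝ), IsFrame a b c ∧ (∀ w, R a b w = z • wedge a b w) ∧
      (∀ w, R a c w = y • wedge a c w) ∧ ∀ w, R b c w = x • wedge b c w := by
  let e₀ : OrthonormalBasis (Fin 3) ℝ V := (stdOrthonormalBasis ℝ V).reindex (finCongr h3)
  have hsymm : S.IsSymmetric := fun u v => by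
    rw [hS e₀, hS e₀, sum_inner, inner_sum]
    exact Finset.sum_congr rfl fun i _ => hR.ricci_symm _ _ _
  obtain ⟨e, k, hk⟩ := hsymm.exists_eigenframe h3
  have he := IsFrame.of_basis e
  -- In dimension three an off-diagonal Ricci entry at i, j is the single component R(e_i, e_k, e_k,
  -- e_j) with k the third index, so a Ricci eigenframe kills all mixed curvature components.
  have hd : ∀ i j, i ≠ j → ⟪∑ t, R (e i) (e t) (e t), e j⟫ = 0 := fun i j hij => by
    rw [← hS e, hk, inner_smul_left, e.orthonormal.2 hij, mul_zero]
  have hz : ∀ u v, ⟪R u v v, v⟫ = 0 := fun u v => by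
    have := hR.skew' u v v v
    linarith
  have h01 := hd 0 1 (by decide)
  have h02 := hd 0 2 (by decide)
  have h12 := hd 1 2 (by decide)
  simp only [Fin.sum_univ_three, inner_add_left, hR.self_left, inner_zero_left, hz] at h01 h02 h12
  obtain ⟨h1, h2, h3⟩ := hR.eq_smul_wedge_of_frame he (by linarith) (by linarith) (by linarith)
  exact ⟨_, _, _, _, _, _, he, h1, h2, h3⟩

end IsAlgCurv

/-- Evaluate the condition at (a, c, c, b; a, b). Both R(a,b) and a∧b annihilate c, so only the
first and last slots contribute, giving z(x - y) = L(x - y). -/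
lemma mul_eq_zero_of_pseudo_symmetric {L x y z : ℝ} (hR : IsAlgCurv R) (h : IsFrame a b c)
    (hab : ∀ w, R a b w = z • wedge a b w) (hac : ∀ w, R a c w = y • wedge a c w)
    (hbc : ∀ w, R b c w = x • wedge b c w)
    (hL : ∀ v₁ v₂ v₃ v₄ x y, -⟪R (R x y v₁) v₂ v₃, v₄⟫ - ⟪R v₁ (R x y v₂) v₃, v₄⟫
      - ⟪R v₁ v₂ (R x y v₃), v₄⟫ - ⟪R v₁ v₂ v₃, R x y v₄⟫ = L *
    (-⟪R (wedge x y v₁) v₂ v₃, v₄⟫ - ⟪R v₁ (wedge x y v₂) v₃, v₄⟫ - ⟪R v₁ v₂ (wedge x y v₃), v₄⟫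
      - ⟪R v₁ v₂ v₃, wedge x y v₄⟫)) : (z - L) * (x - y) = 0 := by
  have key := hL a c c b a b
  have wa : wedge a b a = -b := by simp [wedge, h.aa, h.swap.ab, -inner_self_eq_norm_sq_to_K]
  have wb : wedge a b b = a := by simp [wedge, h.bb, h.ab, -inner_self_eq_norm_sq_to_K]
  have wc : wedge a b c = 0 := by simp [wedge, h.ac, h.bc]
  have zm : ∀ u w, R u 0 w = 0 := fun u w => by simpa using hR.smul_mid 0 u 0 w
  have zr : ∀ u w, R u w 0 = 0 := fun u w => by simpa using hR.smul_right 0 u w 0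
  have nl : ∀ u w, R (-b) u w = - R b u w := fun u w => by simpa using hR.smul_left (-1) b u w
  have hb : ⟪R b c c, b⟫ = x := by
    rw [hbc, wedge, h.cc, h.bc, inner_smul_left, zero_smul, sub_zero, one_smul, h.bb]; simp
  have ha : ⟪R a c c, a⟫ = y := by
    rw [hac, wedge, h.cc, h.ac, inner_smul_left, zero_smul, sub_zero, one_smul, h.aa]; simp
  simp only [hab, wa, wb, wc, smul_neg, smul_zero, zm, zr, inner_zero_left, inner_smul_right, ha,
    nl, inner_neg_left, hb] at key
  have nl' : R (-(z • b)) c c = -(z • R b c c) := by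
    rw [← hR.smul_left]; simpa using hR.smul_left (-1) (z • b) c c
  rw [nl', inner_neg_left, inner_smul_left, hb] at key
  simp only [conj_trivial] at key
  linarith

/-- A pseudo symmetric curvature operator in dimension three has at most two distinct principal
curvatures. -/
lemma exists_hasForm [FiniteDimensional ℝ V] {L : ℝ} (hR : IsAlgCurv R) (h3 : finrank ℝ V = 3)
    {S : V →ₗ[ℝ] V}
    (hS : ∀ (e : OrthonormalBasis (Fin 3) ℝ V) u, S u = ∑ t, R u (e t) (e t))
    (hL : ∀ v₁ v₂ v₃ v₄ x y, -⟪R (R x y v₁) v₂ v₃, v₄⟫ - ⟪R v₁ (R x y v₂) v₃, v₄⟫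
      - ⟪R v₁ v₂ (R x y v₃), v₄⟫ - ⟪R v₁ v₂ v₃, R x y v₄⟫ = L *
    (-⟪R (wedge x y v₁) v₂ v₃, v₄⟫ - ⟪R v₁ (wedge x y v₂) v₃, v₄⟫ - ⟪R v₁ v₂ (wedge x y v₃), v₄⟫
      - ⟪R v₁ v₂ v₃, wedge x y v₄⟫)) :
    ∃ ξ α β, ⟪ξ, ξ⟫ = 1 ∧ HasForm R ξ α β := by
  obtain ⟨a, b, c, x, y, z, h, hab, hac, hbc⟩ := hR.exists_frame h3 hS
  have rev : ∀ {u v : V} {t : ℝ}, (∀ w, R u v w = t • wedge u v w) →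
      ∀ w, R v u w = t • wedge v u w := by
    intro u v t ht w
    rw [hR.swap, ht, ← smul_neg]
    simp [wedge]
  have h1 := mul_eq_zero_of_pseudo_symmetric hR h hab hac hbc hL
  have h2 := mul_eq_zero_of_pseudo_symmetric hR h.rotate hbc (rev hab) (rev hac) hL
  have h3 := mul_eq_zero_of_pseudo_symmetric hR h.rotate.rotate (rev hac) (rev hbc) hab hL
  by_cases hxy : x = y
  · subst hxy
    exact ⟨c, _, _, h.cc, hR.hasForm_of_frame h hab hac hbc⟩
  by_cases hyz : y = z
  · subst hyz
    exact ⟨a, _, _, h.aa, hR.hasForm_of_frame h.rotate hbc (rev hab) (rev hac)⟩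
  by_cases hzx : z = x
  · subst hzx
    exact ⟨b, _, _, h.bb, hR.hasForm_of_frame h.rotate.rotate (rev hac) (rev hbc) hab⟩
  -- If x, y, z are pairwise distinct, the first factors vanish, which makes the curvatures equal to
  -- L.
  exfalso
  have e1 : z - L = 0 := (mul_eq_zero.1 h1).resolve_right (sub_ne_zero.2 hxy)
  have e2 : x - L = 0 := (mul_eq_zero.1 h2).resolve_right (sub_ne_zero.2 hyz)
  exact hzx (by linarith)

/-- The eigenvalue is 2α + β on the orthogonal complement of ξ and 2α + 2β on ξ. Hence the Ricci
operator detects both whether β = 0 and, if not, the line of ξ. -/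
lemma HasForm.ricci {S : V →ₗ[ℝ] V} (h : HasForm R ξ α β) (h3 : finrank ℝ V = 3)
    [FiniteDimensional ℝ V]
    (hS : ∀ (e : OrthonormalBasis (Fin 3) ℝ V) u, S u = ∑ t, R u (e t) (e t)) (hξ : ⟪ξ, ξ⟫ = 1)
    (u : V) : S u = (2 * α + β) • u + (β * ⟪ξ, u⟫) • ξ := by
  let e : OrthonormalBasis (Fin 3) ℝ V := (stdOrthonormalBasis ℝ V).reindex (finCongr h3)
  have he := IsFrame.of_basis e
  have hu := he.expand u
  have hx := he.expand ξ
  have inner_eq : ∀ v w : V, ⟪v, w⟫ =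
      ⟪v, e 0⟫ * ⟪w, e 0⟫ + ⟪v, e 1⟫ * ⟪w, e 1⟫ + ⟪v, e 2⟫ * ⟪w, e 2⟫ := fun v w => by
    conv_lhs => rw [he.expand w]
    simp only [inner_add_right, inner_smul_right, real_inner_comm]
    ring
  have hn := inner_eq ξ ξ
  have hm := inner_eq ξ u
  rw [hξ] at hn
  rw [hS e, Fin.sum_univ_three]
  unfold HasForm at h
  simp only [real_inner_comm u, real_inner_comm ξ] at hu hx
  simp only [h, wedge, he.aa, he.bb, he.cc]
  linear_combination (norm := skip) α • hu + (β * ⟪ξ, u⟫) • hx - (β • hn) • u + (β • hm) • ξ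
  module

/-! ### From sectional curvatures to the normal form -/

/-- The sectional curvature attached to a curvature operator. -/
def sec (R : V → V → V → V) (v w : V) : ℝ := ⟪R v w w, v⟫ / ⟪wedge v w w, v⟫

lemma inner_wedge_self (v w : V) : ⟪wedge v w w, v⟫ = ⟪v, v⟫ * ⟪w, w⟫ - ⟪v, w⟫ ^ 2 := by
  simp only [wedge, inner_sub_left, inner_smul_left, conj_trivial, real_inner_comm]
  ring

/-- It suffices to treat w orthogonal to ξ, as the planes in the quasi space form condition all
contain such a vector. -/
lemma HasForm.sec_eq (h : HasForm R ξ α β) {v w : V} (hv : ⟪v, v⟫ = 1) (hw : ⟪w, w⟫ = 1)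
    (hvw : ⟪v, w⟫ = 0) (hξw : ⟪ξ, w⟫ = 0) : sec R v w = α + β * ⟪ξ, v⟫ ^ 2 := by
  rw [sec, inner_wedge_self, h, hv, hw, hvw]
  simp only [wedge, inner_sub_left, inner_smul_left, inner_add_left, conj_trivial, hv, hw, hvw, hξw]
  ring

lemma sec_of_orthogonal {v w : V} (hvw : ⟪v, w⟫ = 0) (hw : ⟪w, w⟫ = 1) (hv : v ≠ 0) :
    ⟪R v w w, v⟫ = sec R v w * ⟪v, v⟫ := by
  rw [sec, inner_wedge_self, hvw, hw]
  have := inner_self_ne_zero (𝕜 := ℝ).2 hv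
  field_simp
  ring

/-- The Ricci contraction does not depend on the orthonormal basis. -/
lemma IsAlgCurv.ricci_basis_indep [FiniteDimensional ℝ V] {ι ι' : Type*} [Fintype ι] [Fintype ι']
    (hR : IsAlgCurv R) (e : OrthonormalBasis ι ℝ V) (f : OrthonormalBasis ι' ℝ V) (u : V) :
    ∑ t, R u (e t) (e t) = ∑ t, R u (f t) (f t) := by
  refine ext_inner_right ℝ fun z => ?_
  -- The contraction paired with z is minus the trace of x ↦ R(u,x)z.
  let T : V →ₗ[ℝ] V :=
    { toFun := fun x => R u x z
      map_add' := fun x y => hR.add_mid u x y z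
      map_smul' := fun t x => hR.smul_mid t u x z }
  have h : ∀ x, ⟪R u x x, z⟫ = -⟪x, T x⟫ := fun x => by
    rw [hR.skew', real_inner_comm]
    rfl
  simp only [sum_inner, h, Finset.sum_neg_distrib, ← LinearMap.trace_eq_sum_inner]

lemma exists_isFrame [FiniteDimensional ℝ V] (h3 : finrank ℝ V = 3) (hξ : ⟪ξ, ξ⟫ = 1) :
    ∃ b c, IsFrame ξ b c := by
  have hv : Orthonormal ℝ (Set.domRestrict {(0 : Fin 3)} fun _ => ξ) := by
    refine ⟨fun i => ?_, fun i j hij => (hij (Subsingleton.elim _ _)).elim⟩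
    have h : ‖ξ‖ * ‖ξ‖ = 1 := by rw [← real_inner_self_eq_norm_mul_norm, hξ]
    rcases mul_self_eq_one_iff.1 h with h | h
    · exact h
    · linarith [norm_nonneg ξ]
  obtain ⟨e, he⟩ := hv.exists_orthonormalBasis_extension_of_card_eq (by simp [h3])
  have := IsFrame.of_basis e
  rw [he 0 rfl] at this
  exact ⟨_, _, this⟩

/-- It is enough to show that the frame diagonalizes R. The case K = k is allowed, so that constant
curvature is covered as well. -/
lemma hasForm_of_quasi (hR : IsAlgCurv R) (h : IsFrame a b c) {K k : ℝ}
    (hq : ∀ X' Y', ⟪a, X'⟫ = 0 → ⟪a, Y'⟫ = 0 → ⟪X', X'⟫ = 1 → ⟪Y', Y'⟫ = 1 → ⟪X', Y'⟫ = 0 →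
      ∀ θ ∈ Set.Icc (0 : ℝ) (Real.pi / 2), sec R (Real.cos θ • a + Real.sin θ • X') Y'
        = K * Real.cos θ ^ 2 + k * Real.sin θ ^ 2) : HasForm R a k (K - k) := by
  have hpi := Real.pi_pos
  have key : ∀ X' Y', ⟪a, X'⟫ = 0 → ⟪a, Y'⟫ = 0 → ⟪X', X'⟫ = 1 → ⟪Y', Y'⟫ = 1 → ⟪X', Y'⟫ = 0 →
      ⟪R a Y' Y', a⟫ = K ∧ ⟪R X' Y' Y', X'⟫ = k ∧ ⟪R a Y' Y', X'⟫ = 0 := by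
    intro X' Y' h1 h2 h3 h4 h5
    have h6 : ∀ θ ∈ Set.Icc (0 : ℝ) (Real.pi / 2), ⟪R (Real.cos θ • a + Real.sin θ • X') Y' Y',
        Real.cos θ • a + Real.sin θ • X'⟫ = K * Real.cos θ ^ 2 + k * Real.sin θ ^ 2 := by
      intro θ hθ
      have hn : ⟪Real.cos θ • a + Real.sin θ • X', Real.cos θ • a + Real.sin θ • X'⟫ = 1 := by
        simp only [inner_add_left, inner_add_right, inner_smul_left, inner_smul_right, conj_trivial,
          h.aa, h1, h3, real_inner_comm a X']
        linarith [Real.sin_sq_add_cos_sq θ]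
      rw [sec_of_orthogonal _ h4, hq X' Y' h1 h2 h3 h4 h5 θ hθ, hn, mul_one]
      · intro h0
        rw [h0, inner_zero_left] at hn
        exact zero_ne_one hn
      · rw [inner_add_left, inner_smul_left, inner_smul_left, h2, h5]; simp
    -- The angles 0 and π/2 give the two curvatures; π/4 then isolates the mixed component R(a, Y',
    -- Y', X').
    have e0 := h6 0 ⟨le_rfl, by linarith⟩
    have e1 := h6 (Real.pi / 2) ⟨by linarith, le_rfl⟩
    have e2 := h6 (Real.pi / 4) ⟨by linarith, by linarith⟩
    simp only [Real.cos_zero, Real.sin_zero, one_smul, zero_smul, add_zero, one_pow, mul_one, ne_eq,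
      OfNat.ofNat_ne_zero, not_false_eq_true, zero_pow, mul_zero] at e0
    simp only [Real.cos_pi_div_two, Real.sin_pi_div_two, one_smul, zero_smul, zero_add, one_pow,
      mul_one, ne_eq, OfNat.ofNat_ne_zero, not_false_eq_true, zero_pow, mul_zero] at e1
    refine ⟨e0, e1, ?_⟩
    rw [Real.cos_pi_div_four, Real.sin_pi_div_four, ← smul_add, hR.smul_left, inner_smul_left,
      inner_smul_right, hR.add_left, inner_add_left, inner_add_right, inner_add_right, e0, e1,
      hR.ricci_symm X' a Y', conj_trivial, real_inner_comm X'] at e2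
    have h2' : (√2 / 2) * (√2 / 2) = 1 / 2 := by
      rw [div_mul_div_comm, Real.mul_self_sqrt (by norm_num)]; norm_num
    have h2'' : (√2 / 2) ^ 2 = 1 / 2 := by rw [sq, h2']
    rw [h2'', ← mul_assoc, h2', real_inner_comm] at e2
    linarith [real_inner_comm X' (R a Y' Y')]
  obtain ⟨x1, x2, x3⟩ := key b c h.ab h.ac h.bb h.cc h.bc
  obtain ⟨y1, y2, y3⟩ := key c b h.ac h.ab h.cc h.bb h.rotate.swap.ab
  have s : (√2)⁻¹ * (√2)⁻¹ = 1 / 2 := by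
    rw [← mul_inv, Real.mul_self_sqrt (by norm_num)]; norm_num
  -- The pairs (b,c) and (c,b) leave the component R(a,b,c,a). The frame rotated by π/4 gives R(a,
  -- b+c, b+c, a) = 2K, whose cross term is this component.
  obtain ⟨z1, -, -⟩ := key ((√2)⁻¹ • (b - c)) ((√2)⁻¹ • (b + c))
    (by simp [inner_smul_right, inner_sub_right, h.ab, h.ac])
    (by simp [inner_smul_right, inner_add_right, h.ab, h.ac])
    (by rw [inner_smul_left, inner_smul_right, inner_sub_left, inner_sub_right, inner_sub_right,
          h.bb, h.cc, h.bc, h.rotate.swap.ab, conj_trivial, ← mul_assoc, s]; norm_num)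
    (by rw [inner_smul_left, inner_smul_right, inner_add_left, inner_add_right, inner_add_right,
          h.bb, h.cc, h.bc, h.rotate.swap.ab, conj_trivial, ← mul_assoc, s]; norm_num)
    (by rw [inner_smul_left, inner_smul_right, inner_sub_left, inner_add_right, inner_add_right,
          h.bb, h.cc, h.bc, h.rotate.swap.ab]; simp)
  rw [hR.smul_mid, hR.smul_right, smul_smul, s, inner_smul_left, hR.add_mid, hR.add_right,
    hR.add_right, inner_add_left, inner_add_left, inner_add_left, x1, y1, hR.pair_symm a b c a,
    hR.swap' c a a b, hR.skew' a c a b, neg_neg] at z1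
  have w1 : ⟪R b a a, c⟫ = 0 := by
    rw [hR.swap', hR.pair_symm, hR.skew']
    simp only [conj_trivial] at z1
    linarith [hR.skew' a c b a]
  obtain ⟨h1, h2, h3⟩ := hR.eq_smul_wedge_of_frame h x3 y3 w1
  rw [y1] at h1
  rw [x1] at h2
  rw [x2] at h3
  have rev : ∀ {u v : V} {t : ℝ}, (∀ w, R u v w = t • wedge u v w) →
      ∀ w, R v u w = t • wedge v u w := by
    intro u v t ht w
    rw [hR.swap, ht, ← smul_neg]
    simp [wedge]
  exact hR.hasForm_of_frame h.rotate h3 (rev h1) (rev h2)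

/-- Constant curvature is the quasi constant condition with K = k, for any choice of unit vector. -/
lemma hasForm_of_constant [FiniteDimensional ℝ V] (hR : IsAlgCurv R) (h3 : finrank ℝ V = 3) {k : ℝ}
    (hk : ∀ v w, LinearIndependent ℝ ![v, w] → sec R v w = k) :
    ∃ ξ, ⟪ξ, ξ⟫ = 1 ∧ HasForm R ξ k 0 := by
  let e : OrthonormalBasis (Fin 3) ℝ V := (stdOrthonormalBasis ℝ V).reindex (finCongr h3)
  have h := IsFrame.of_basis e
  refine ⟨e 0, h.aa, ?_⟩
  have hq := hasForm_of_quasi (K := k) (k := k) hR h fun X' Y' h1 h2 h3 h4 h5 θ hθ => by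
    have hn : ⟪Real.cos θ • e 0 + Real.sin θ • X', Real.cos θ • e 0 + Real.sin θ • X'⟫ = 1 := by
      simp only [inner_add_left, inner_add_right, inner_smul_left, inner_smul_right, conj_trivial,
        h.aa, h1, h3, real_inner_comm (e 0) X']
      linarith [Real.sin_sq_add_cos_sq θ]
    have ho : ⟪Real.cos θ • e 0 + Real.sin θ • X', Y'⟫ = 0 := by
      rw [inner_add_left, inner_smul_left, inner_smul_left, h2, h5]; simp
    rw [hk]
    · linear_combination -k * Real.sin_sq_add_cos_sq θ
    · rw [LinearIndependent.pair_iff]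
      intro s t hst
      have i1 := congrArg (fun x => ⟪x, Y'⟫) hst
      have i2 := congrArg (fun x => ⟪Real.cos θ • e 0 + Real.sin θ • X', x⟫) hst
      simp only [inner_add_left (s • _), inner_add_right _ (s • _), inner_smul_left (𝕜 := ℝ) _ _ s,
        inner_smul_left (𝕜 := ℝ) _ _ t, inner_smul_right _ _ s, inner_smul_right _ _ t, hn, ho, h4,
        inner_zero_left, inner_zero_right, conj_trivial] at i1 i2
      constructor <;> linarith
  rwa [sub_self] at hq

lemma HasForm.sec_eq_of_linearIndependent {v w : V} (h : HasForm R ξ α 0)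
    (hvw : LinearIndependent ℝ ![v, w]) : sec R v w = α := by
  have hne : ⟪wedge v w w, v⟫ ≠ 0 := by
    intro h0
    rw [inner_wedge_self] at h0
    -- The equality case of Cauchy-Schwarz: the squared norm of this vector is ⟨w,w⟩ times the Gram
    -- determinant.
    have hz : ⟪w, w⟫ • v + (-⟪v, w⟫) • w = 0 := by
      rw [← inner_self_eq_zero (𝕜 := ℝ)]
      simp only [inner_add_left, inner_add_right, inner_smul_left, inner_smul_right, conj_trivial]
      rw [real_inner_comm v w]
      linear_combination ⟪w, w⟫ * h0
    have := (LinearIndependent.pair_iff.1 hvw _ _ hz).1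
    rw [inner_self_eq_zero] at this
    exact hvw.ne_zero 1 this
  rw [sec, h]
  simp only [zero_smul, add_zero, inner_smul_left, conj_trivial]
  exact mul_div_cancel_right₀ _ hne

end Algebra

/-! ### Curvature operators of a Riemannian manifold and the Schur lemma -/

section

variable {n : ℕ} {M : Type*} [TopologicalSpace M] [ChartedSpace (EuclideanSpace ℝ (Fin n)) M]
  [IsManifold (𝓡 n) ∞ M] [RiemannianBundle (fun p : M => TangentSpace (𝓡 n) p)]
  [IsContMDiffRiemannianBundle (𝓡 n) ∞ (EuclideanSpace ℝ (Fin n))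
      (fun p : M => TangentSpace (𝓡 n) p)]
  {X X' Y Y' Z Z' : (y : M) → TangentSpace (𝓡 n) y} {p : M} {f : M → ℝ}

/-- Each law is read off from the fields `ext`. For linearity, `ext u + ext u'` is used as one more
smooth field with value u + u', which `curvOp_apply` permits. -/
lemma curvOp_isAlgCurv (p : M) : IsAlgCurv (curvOp (n := n) p) := by
  have s : ∀ u : TangentSpace (𝓡 n) p, SmoothAt (ext u) p := smoothAt_ext
  have e : ∀ u v w, curvOp p u v w = curv (ext u) (ext v) (ext w) p := fun u v w => by
    rw [← curvOp_apply (s u) (s v) (s w), ext_self, ext_self, ext_self]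
  have c : ∀ t : ℝ, ContMDiffAt (𝓡 n) 𝓘(ℝ) ∞ (fun _ : M => t) p := fun t => contMDiffAt_const
  refine ⟨fun u u' v w => ?_, fun t u v w => ?_, fun u v w w' => ?_, fun t u v w => ?_,
    fun u v w => ?_, fun u v w z => ?_, fun u v w => ?_⟩
  · rw [e u, e u', ← curv_add_left (s u) (s u') (s v) (s w),
      ← curvOp_apply ((s u).add (s u')) (s v) (s w)]
    simp
  · rw [e u, ← curv_smul_left (c t) (s u) (s v) (s w), ← curvOp_apply ((s u).smul (c t)) (s v) (s w)]
    simp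
  · rw [e u v w, e u v w', ← curv_add_right (s u) (s v) (s w) (s w'),
      ← curvOp_apply (s u) (s v) ((s w).add (s w'))]
    simp
  · rw [e u v w, ← curv_smul_right (c t) (s u) (s v) (s w),
      ← curvOp_apply (s u) (s v) ((s w).smul (c t))]
    simp
  · rw [e, e, curv_swap (s w)]
  · have := inner_curv_add_inner_curv (s u) (s v) (s w) (s z)
    rwa [← e, ← e, ext_self, ext_self] at this
  · have := curv_cyclic (s u) (s v) (s w)
    rwa [← e, ← e, ← e] at this

/-- The definition fixes values on one frame only; linearity of the contraction and its independence
of the basis give the formula everywhere. -/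
lemma ricciOp_apply {ι : Type*} [Fintype ι] (e : OrthonormalBasis ι ℝ (TangentSpace (𝓡 n) p))
    (u : TangentSpace (𝓡 n) p) : ricciOp p u = ∑ t, curvOp p u (e t) (e t) := by
  have hR := curvOp_isAlgCurv (n := n) p
  let T : TangentSpace (𝓡 n) p →ₗ[ℝ] TangentSpace (𝓡 n) p :=
    { toFun := fun u => ∑ t, curvOp p u (frame p t) (frame p t)
      map_add' := fun x y => by
        rw [← Finset.sum_add_distrib]
        exact Finset.sum_congr rfl fun t _ => hR.add_left _ _ _ _
      map_smul' := fun r x => by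
        rw [RingHom.id_apply, Finset.smul_sum]
        exact Finset.sum_congr rfl fun t _ => hR.smul_left _ _ _ _ }
  have hT : ricciOp p = T := by
    refine (frame p).toBasis.ext fun i => ?_
    rw [ricciOp, Basis.constr_basis, OrthonormalBasis.coe_toBasis]
    rfl
  rw [hR.ricci_basis_indep e (frame p), hT]
  rfl

/-- The Ricci operator preserves smoothness. -/
lemma smoothAt_ricciOp (hX : ∀ᶠ y in 𝓝 p, SmoothAt X y) :
    ∀ᶠ y in 𝓝 p, SmoothAt (fun y => ricciOp y (X y)) y := by
  obtain ⟨E, hE⟩ := exists_orthonormal_frame (n := n) p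
  have h : ∀ᶠ y in 𝓝 p, ricciOp y (X y) = ∑ i, curv X (E i) (E i) y := by
    filter_upwards [hE, hX] with y hy hXy
    rw [ricciOp_apply (hy.2.toBasis (by simp [finrank_tangentSpace]))]
    refine Finset.sum_congr rfl fun i _ => ?_
    rw [Orthonormal.toBasis_apply, curvOp_apply hXy (hy.1 i) (hy.1 i)]
  filter_upwards [hE, hX, h.eventually_nhds] with y hy hXy h
  refine SmoothAt.congr (X := fun y => ∑ i, curv X (E i) (E i) y)
    (ContMDiffAt.sum_section fun i _ => hXy.curv (hy.1 i) (hy.1 i)) h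

/-- Schur's lemma, pointwise. -/
lemma mvfderiv_eq_zero_of_curvOp_eq_smul_wedge {α : M → ℝ} {E : Fin n → (y : M) → TangentSpace (𝓡 n) y}
    (hα : ∀ y (u v w : TangentSpace (𝓡 n) y), curvOp y u v w = α y • wedge u v w)
    (hE : ∀ᶠ y in 𝓝 p, (∀ i, SmoothAt (E i) y) ∧ Orthonormal ℝ fun i => E i y)
    (hαs : MDifferentiableAt (𝓡 n) 𝓘(ℝ) α p) {i j k : Fin n} (hij : i ≠ j) (hik : i ≠ k) (hjk : j ≠ k) :
    mvfderiv (𝓡 n) α p (E i p) = 0 := by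
  have hs := fun a => hE.self_of_nhds.1 a
  have hon : ∀ y, (Orthonormal ℝ fun i => E i y) → ∀ a b, ⟪E a y, E b y⟫ = if a = b then 1 else 0 :=
    fun y hy => orthonormal_iff_ite.1 hy
  have ho := hon p hE.self_of_nhds.2
  have hcurv : ∀ a b c, ∀ᶠ y in 𝓝 p, curv (E a) (E b) (E c) y = α y • wedge (E a y) (E b y) (E c y) := by
    intro a b c
    filter_upwards [hE] with y hy
    rw [← hα, curvOp_apply (hy.1 a) (hy.1 b) (hy.1 c)]
  have hskew : ∀ a b (u : TangentSpace (𝓡 n) p), ⟪nabla (E a) p u, E b p⟫ + ⟪nabla (E b) p u, E a p⟫ = 0 := by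
    intro a b u
    have h1 := mvfderiv_inner (hs a).diffAt (hs b).diffAt u
    have h2 : ∀ᶠ y in 𝓝 p, ⟪E a y, E b y⟫ = if a = b then 1 else 0 := by
      filter_upwards [hE] with y hy using hon y hy.2 a b
    rw [mvfderiv_congr h2, mvfderiv_const] at h1
    rw [real_inner_comm (E a p), ← h1]
    rfl
  have e1 : ∀ᶠ y in 𝓝 p, curv (E j) (E k) (E k) y = (α • E j) y := by
    filter_upwards [hcurv j k k, hE] with y hy hy'
    simp [hy, wedge, hon y hy'.2, hjk, -inner_self_eq_norm_sq_to_K]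
  have e2 : ∀ᶠ y in 𝓝 p, curv (E k) (E i) (E k) y = ((-α) • E i) y := by
    filter_upwards [hcurv k i k, hE] with y hy hy'
    simp [hy, wedge, hon y hy'.2, hik, -inner_self_eq_norm_sq_to_K]
  -- Zero is written as a multiple of a frame field so that the Leibniz rule applies as in the other
  -- two cases.
  have e3 : ∀ᶠ y in 𝓝 p, curv (E i) (E j) (E k) y = ((fun _ : M => (0 : ℝ)) • E k) y := by
    filter_upwards [hcurv i j k, hE] with y hy hy'
    simp [hy, wedge, hon y hy'.2, hik, hjk]
  have B := nabla_curv_cyclic (hs i) (hs j) (hs k) (hs k)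
  rw [nabla_congr e1, nabla_congr e2, nabla_congr e3, nabla_smul hαs (hs j).diffAt,
    nabla_smul hαs.neg (hs i).diffAt, nabla_smul mdifferentiableAt_const (hs k).diffAt,
    ← curvOp_apply (hs j) (hs k) ((hs i).nabla (hs k)),
    ← curvOp_apply (hs k) (hs i) ((hs j).nabla (hs k)),
    ← curvOp_apply (hs i) (hs j) ((hs k).nabla (hs k)),
    ← curvOp_apply (hs i) ((hs j).mlieBracket (hs k)) (hs k),
    ← curvOp_apply (hs j) ((hs k).mlieBracket (hs i)) (hs k),
    ← curvOp_apply (hs k) ((hs i).mlieBracket (hs j)) (hs k),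
    ← nabla_sub_nabla (hs j).diffAt (hs k).diffAt, ← nabla_sub_nabla (hs k).diffAt (hs i).diffAt,
    ← nabla_sub_nabla (hs i).diffAt (hs j).diffAt, mvfderiv_const] at B
  -- In the Bianchi identity for E_i, E_j, E_k applied to E_k, the derivative terms are (E_i α) E_j
  -- - (E_j α) E_i. Pairing with E_j isolates E_i α, and the connection terms cancel by skewness of
  -- the connection coefficients.
  have B' := congrArg (fun x => ⟪x, E j p⟫) B
  simp only [hα, wedge, inner_add_left, inner_sub_left, inner_smul_left, ho, hij, hik, hjk,
    hjk.symm, if_true, if_false, conj_trivial, inner_zero_left] at B'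
  rw [real_inner_comm (nabla (E k) p (E i p)), real_inner_comm (nabla (E k) p (E k p)) (E i p)] at B'
  simp only [mul_zero, zero_mul, Pi.neg_apply] at B'
  linear_combination B' + α p * hskew k k (E i p) - α p * hskew i k (E k p)

end

/-! ### Deszcz symmetric three-manifolds -/

section Algebra
variable {V : Type*} [NormedAddCommGroup V] [InnerProductSpace ℝ V] [FiniteDimensional ℝ V]
  {R : V → V → V → V} {ξ : V} {α β : ℝ}

omit [FiniteDimensional ℝ V] in
lemma orthonormal_triple {a b c : V} (aa : ⟪a, a⟫ = 1) (bb : ⟪b, b⟫ = 1) (cc : ⟪c, c⟫ = 1)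
    (ab : ⟪a, b⟫ = 0) (ac : ⟪a, c⟫ = 0) (bc : ⟪b, c⟫ = 0) : Orthonormal ℝ ![a, b, c] := by
  rw [orthonormal_iff_ite]
  intro i j
  fin_cases i <;> fin_cases j
  · exact aa
  · exact ab
  · exact ac
  · exact (real_inner_comm a b).trans ab
  · exact bb
  · exact bc
  · exact (real_inner_comm a c).trans ac
  · exact (real_inner_comm b c).trans bc
  · exact cc

lemma hasForm_of_orthonormal (hR : IsAlgCurv R) (h3 : finrank ℝ V = 3) (hξ : ⟪ξ, ξ⟫ = 1) {K k : ℝ}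
    (hq : ∀ X' Y', ⟪ξ, X'⟫ = 0 → ⟪ξ, Y'⟫ = 0 → Orthonormal ℝ ![ξ, X', Y'] →
      ∀ θ ∈ Set.Icc (0 : ℝ) (Real.pi / 2), sec R (Real.cos θ • ξ + Real.sin θ • X') Y'
        = K * Real.cos θ ^ 2 + k * Real.sin θ ^ 2) : HasForm R ξ k (K - k) := by
  obtain ⟨b, c, hf⟩ := exists_isFrame h3 hξ
  exact hasForm_of_quasi hR hf fun X' Y' h1 h2 h3 h4 h5 =>
    hq X' Y' h1 h2 (orthonormal_triple hξ h3 h4 h1 h2 h5)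

lemma eq_of_forall_eq_smul (h3 : finrank ℝ V = 3) (hξ : ⟪ξ, ξ⟫ = 1) {S : V → V} {s t ρ : ℝ}
    (hS : ∀ u, S u = s • u + (t * ⟪ξ, u⟫) • ξ) (hρ : ∀ u, S u = ρ • u) : ρ = s ∧ t = 0 := by
  obtain ⟨b, c, hf⟩ := exists_isFrame h3 hξ
  have h1 := congrArg (fun x => ⟪b, x⟫) (hρ b)
  have h2 := congrArg (fun x => ⟪ξ, x⟫) (hρ ξ)
  simp only [hS, inner_add_right, inner_smul_right, hξ, hf.ab, hf.bb] at h1 h2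
  constructor <;> linarith

end Algebra

variable {M : Type*} [TopologicalSpace M] [ChartedSpace (EuclideanSpace ℝ (Fin 3)) M]
  [IsManifold (𝓡 3) ∞ M] [RiemannianBundle (fun p : M => TangentSpace (𝓡 3) p)]
  [IsContMDiffRiemannianBundle (𝓡 3) ∞ (EuclideanSpace ℝ (Fin 3))
      (fun p : M => TangentSpace (𝓡 3) p)]
  {ξ : (p : M) → TangentSpace (𝓡 3) p} {α β : M → ℝ}

lemma isDeszczSymmetric_of_hasForm
    (h : ∀ p : M, ∃ (ξ : TangentSpace (𝓡 3) p) (α β : ℝ), ⟪ξ, ξ⟫ = 1 ∧ HasForm (curvOp p) ξ α β) :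
    IsDeszczSymmetric 3 M := by
  choose ξ α β hξ h using h
  exact ⟨fun p => α p + β p, fun p v₁ v₂ v₃ v₄ x y => (h p).pseudo_symmetric (hξ p) v₁ v₂ v₃ v₄ x y⟩

lemma exists_hasForm_of_isDeszczSymmetric (h : IsDeszczSymmetric 3 M) (p : M) :
    ∃ (ξ : TangentSpace (𝓡 3) p) (α β : ℝ), ⟪ξ, ξ⟫ = 1 ∧ HasForm (curvOp p) ξ α β := by
  obtain ⟨L, hL⟩ := h
  exact exists_hasForm (curvOp_isAlgCurv p) (finrank_tangentSpace p) (fun e u => ricciOp_apply e u)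
    fun v₁ v₂ v₃ v₄ x y => hL p v₁ v₂ v₃ v₄ x y

lemma exists_hasForm_of_isRealSpaceForm (h : IsRealSpaceForm 3 M) (p : M) :
    ∃ (ξ : TangentSpace (𝓡 3) p) (α β : ℝ), ⟪ξ, ξ⟫ = 1 ∧ HasForm (curvOp p) ξ α β := by
  obtain ⟨c, hc⟩ := h
  obtain ⟨ξ, hξ⟩ := hasForm_of_constant (curvOp_isAlgCurv p) (finrank_tangentSpace p)
    fun v w hvw => hc p v w hvw
  exact ⟨ξ, c, 0, hξ⟩

lemma exists_hasForm_of_isQuasiSpaceForm (h : IsQuasiSpaceForm 3 M) (p : M) :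
    ∃ (ξ : TangentSpace (𝓡 3) p) (α β : ℝ), ⟪ξ, ξ⟫ = 1 ∧ HasForm (curvOp p) ξ α β := by
  obtain ⟨q, h1, h2, D, hD, hq, -⟩ := h
  -- 1 ≤ q and 2q ≤ 3.
  obtain rfl : q = 1 := by omega
  obtain ⟨K, k, -, hK⟩ := hq rfl
  obtain ⟨U, -, hpU, X, -, hX⟩ := hD p
  obtain ⟨hli, hDp⟩ := hX p hpU
  have hX0 : X 0 p ≠ 0 := hli.ne_zero 0
  have hr : Set.range (fun i => X i p) = {X 0 p} := by
    rw [Set.range_unique]; rfl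
  rw [hr] at hDp
  have hn : ‖X 0 p‖ ≠ 0 := norm_ne_zero_iff.2 hX0
  obtain ⟨ξ, hξdef⟩ : ∃ ξ : TangentSpace (𝓡 3) p, ξ = ‖X 0 p‖⁻¹ • X 0 p := ⟨_, rfl⟩
  have hξ : ⟪ξ, ξ⟫ = 1 := by
    rw [hξdef, inner_smul_left, inner_smul_right, real_inner_self_eq_norm_mul_norm, conj_trivial]
    field_simp
  have hξD : ξ ∈ D p := by
    rw [hDp, hξdef]
    exact Submodule.smul_mem _ _ (Submodule.mem_span_singleton_self _)
  have hperp : ∀ w, ⟪ξ, w⟫ = 0 → w ∈ (D p)ᗮ := by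
    intro w hw
    rw [hDp, Submodule.mem_orthogonal_singleton_iff_inner_right]
    rw [hξdef, inner_smul_left, conj_trivial] at hw
    exact (mul_eq_zero.1 hw).resolve_left (inv_ne_zero hn)
  have hform : HasForm (curvOp p) ξ (k p) (K p - k p) :=
    hasForm_of_orthonormal (curvOp_isAlgCurv p) (finrank_tangentSpace p) hξ fun X' Y' h1 h2 ho =>
      hK p ξ X' Y' hξD (hperp _ h1) (hperp _ h2) ho
  exact ⟨ξ, _, _, hξ, hform⟩

/-- Schur's lemma. -/
lemma isRealSpaceForm_of_hasForm [ConnectedSpace M] (h : ∀ p, HasForm (curvOp p) (ξ p) (α p) 0) :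
    IsRealSpaceForm 3 M := by
  have hα : ∀ y (u v w : TangentSpace (𝓡 3) y), curvOp y u v w = α y • wedge u v w :=
    fun y u v w => by rw [h y, zero_smul, add_zero]
  have key : ∀ p, MDifferentiableAt (𝓡 3) 𝓘(ℝ) α p ∧ mvfderiv (𝓡 3) α p = 0 := by
    intro p
    obtain ⟨E, hE⟩ := exists_orthonormal_frame (n := 3) p
    obtain ⟨hs, ho⟩ := hE.self_of_nhds
    -- α is only given pointwise; it is differentiable because it is the curvature component
    -- ⟨R(E_0,E_1)E_1, E_0⟩ of a smooth frame.
    have hs' : MDifferentiableAt (𝓡 3) 𝓘(ℝ) α p := by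
      refine MDifferentiableAt.congr_of_eventuallyEq
        (((hs 0).curv (hs 1) (hs 1)).diffAt.inner (hs 0).diffAt) ?_
      filter_upwards [hE] with y hy
      have ho := orthonormal_iff_ite.1 hy.2
      rw [← curvOp_apply (hy.1 0) (hy.1 1) (hy.1 1), hα]
      simp [wedge, ho, inner_smul_left, -inner_self_eq_norm_sq_to_K]
    refine ⟨hs', ?_⟩
    have hd : ∀ i j k : Fin 3, i ≠ j → i ≠ k → j ≠ k → mvfderiv (𝓡 3) α p (E i p) = 0 :=
      fun i j k => mvfderiv_eq_zero_of_curvOp_eq_smul_wedge hα hE hs'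
    have hd' : ∀ i, mvfderiv (𝓡 3) α p (E i p) = 0 := by
      intro i
      fin_cases i
      · exact hd 0 1 2 (by decide) (by decide) (by decide)
      · exact hd 1 0 2 (by decide) (by decide) (by decide)
      · exact hd 2 0 1 (by decide) (by decide) (by decide)
    ext u
    rw [← (ho.toBasis (by simp [finrank_tangentSpace])).sum_repr u]
    simp [Orthonormal.toBasis_apply, hd']
  obtain ⟨p₀⟩ : Nonempty M := inferInstance
  refine ⟨α p₀, fun p v w hvw => ?_⟩
  rw [← eq_of_mvfderiv_eq_zero (fun p => (key p).1) (fun p => (key p).2) p p₀]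
  exact (h p).sec_eq_of_linearIndependent hvw

/-! ### Ricci multiplicities and the exceptional direction -/

lemma ricciMultiplicity_eq_three_iff (p : M) (ρ : ℝ) :
    ricciMultiplicity 3 p ρ = 3 ↔ ∀ u : TangentSpace (𝓡 3) p, ricciOp p u = ρ • u := by
  rw [ricciMultiplicity]
  constructor
  · intro h3 u
    have htop := Submodule.eq_top_of_finrank_eq (h3.trans (finrank_tangentSpace p).symm)
    exact End.mem_eigenspace_iff.1 (htop ▸ Submodule.mem_top)
  · intro hu
    have htop : End.eigenspace (ricciOp (n := 3) p) ρ = ⊤ :=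
      Submodule.eq_top_iff'.2 fun u => End.mem_eigenspace_iff.2 (hu u)
    rw [htop, finrank_top, finrank_tangentSpace]

lemma ricciMultiplicity_eq_three_iff_of_hasForm {p : M} {ξ : TangentSpace (𝓡 3) p} {α β : ℝ}
    (h : HasForm (curvOp p) ξ α β) (hξ : ⟪ξ, ξ⟫ = 1) (ρ : ℝ) :
    ricciMultiplicity 3 p ρ = 3 ↔ ρ = 2 * α + β ∧ β = 0 := by
  have hS : ∀ u, ricciOp p u = (2 * α + β) • u + (β * ⟪ξ, u⟫) • ξ :=
    h.ricci (finrank_tangentSpace p) (fun e u => ricciOp_apply e u) hξ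
  rw [ricciMultiplicity_eq_three_iff]
  have h3 := finrank_tangentSpace (n := 3) p
  refine ⟨fun hρ => eq_of_forall_eq_smul (S := fun u => ricciOp p u) h3 hξ hS hρ, ?_⟩
  rintro ⟨rfl, hβ⟩ u
  rw [hS, hβ, zero_mul, zero_smul, add_zero]

/-- The number of triple Ricci eigenvalues tells β = 0 from β ≠ 0; its constancy gives the dichotomy
of the theorem. -/
lemma ncard_ricciMultiplicity_three {p : M} {ξ : TangentSpace (𝓡 3) p} {α β : ℝ}
    (h : HasForm (curvOp p) ξ α β) (hξ : ⟪ξ, ξ⟫ = 1) :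
    {ρ : ℝ | ricciMultiplicity 3 p ρ = 3}.ncard = if β = 0 then 1 else 0 := by
  simp only [ricciMultiplicity_eq_three_iff_of_hasForm h hξ]
  split_ifs with hβ <;> simp [hβ]

/-- The exceptional direction spans a smooth distribution. -/
lemma isSmoothDistribution_span (h : ∀ p, HasForm (curvOp p) (ξ p) (α p) (β p))
    (hξ : ∀ p, ⟪ξ p, ξ p⟫ = 1) (hβ : ∀ p, β p ≠ 0) :
    IsSmoothDistribution 1 fun p => Submodule.span ℝ {ξ p} := by
  intro p
  have hS : ∀ p u, ricciOp p u = (2 * α p + β p) • u + (β p * ⟪ξ p, u⟫) • ξ p :=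
    fun p => (h p).ricci (finrank_tangentSpace p) (fun e u => ricciOp_apply e u) (hξ p)
  obtain ⟨E, hE⟩ := exists_orthonormal_frame (n := 3) p
  have hEs : ∀ i, ∀ᶠ y in 𝓝 p, SmoothAt (E i) y := fun i => hE.mono fun y hy => hy.1 i
  have hR := fun i => smoothAt_ricciOp (hEs i)
  have hRR := fun i => smoothAt_ricciOp (hR i)
  -- With s = tr S and t = tr S² for the Ricci operator S, V_i is χ'(S)/3 applied to E_i, where χ is
  -- the characteristic polynomial. It vanishes on the double eigenspace, and its value at the
  -- simple eigenvalue is (difference of the eigenvalues)²/3 = β²/3. Its coefficients are traces,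
  -- hence smooth without any smoothness of α, β or ξ.
  let s : M → ℝ := fun y => ∑ i, ⟪E i y, ricciOp y (E i y)⟫
  let t : M → ℝ := fun y => ∑ i, ⟪ricciOp y (E i y), ricciOp y (E i y)⟫
  let V : Fin 3 → (y : M) → TangentSpace (𝓡 3) y := fun i =>
    (fun y => ricciOp y (ricciOp y (E i y))) + (fun y => -(2 / 3) * s y) • (fun y => ricciOp y (E i y))
      + (fun y => (s y * s y - t y) / 6) • E i
  have hV : ∀ i, ∀ᶠ y in 𝓝 p, SmoothAt (V i) y := by
    intro i
    filter_upwards [hE, Filter.eventually_all.2 hR, hRR i] with y h1 h2 h3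
    have hs : ContMDiffAt (𝓡 3) 𝓘(ℝ) ∞ s y := ContMDiffAt.sum fun i _ => (h1.1 i).inner (h2 i)
    have ht : ContMDiffAt (𝓡 3) 𝓘(ℝ) ∞ t y := ContMDiffAt.sum fun i _ => (h2 i).inner (h2 i)
    exact (h3.add ((h2 i).smul (contMDiffAt_const.mul hs))).add
      ((h1.1 i).smul (((hs.mul hs).sub ht).div_const 6))
  have hVe : ∀ i, ∀ᶠ y in 𝓝 p, V i y = (β y ^ 2 / 3 * ⟪ξ y, E i y⟫) • ξ y := by
    intro i
    filter_upwards [hE] with y hy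
    have ho := orthonormal_iff_ite.1 hy.2
    have hn : ∑ i, ⟪ξ y, E i y⟫ * ⟪ξ y, E i y⟫ = 1 := by
      rw [← hξ y]
      have := (hy.2.toBasis (by simp [finrank_tangentSpace])).sum_inner_mul_inner (ξ y) (ξ y)
      simp only [Orthonormal.toBasis_apply] at this
      rw [← this]
      simp only [real_inner_comm (ξ y)]
    rw [Fin.sum_univ_three] at hn
    have hs : s y = 6 * α y + 4 * β y := by
      simp only [s, hS, inner_add_right, inner_smul_right, ho, if_true, Fin.sum_univ_three,
        real_inner_comm (ξ y)]
      linear_combination β y * hn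
    have ht : t y = 3 * (2 * α y + β y) ^ 2 + 2 * (2 * α y + β y) * β y + β y ^ 2 := by
      simp only [t, hS, inner_add_right, inner_add_left, inner_smul_left, inner_smul_right, ho,
        if_true, Fin.sum_univ_three, real_inner_comm (ξ y), conj_trivial, hξ]
      linear_combination (2 * (2 * α y + β y) * β y + β y ^ 2) * hn
    simp only [V, Pi.add_apply, Pi.smul_apply', hS, hs, ht, inner_add_right, inner_smul_right, hξ]
    module
  have hξ0 : ∀ y, ξ y ≠ 0 := fun y h0 => by
    have := hξ y
    rw [h0, inner_zero_left] at this; exact zero_ne_one this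
  -- Some frame vector is not orthogonal to ξ at p; its V_i is nonzero near p and spans the line of
  -- ξ there.
  obtain ⟨i, hi⟩ : ∃ i, ⟪ξ p, E i p⟫ ≠ 0 := by
    by_contra! hall
    refine hξ0 p ?_
    rw [← (hE.self_of_nhds.2.toBasis (by simp [finrank_tangentSpace])).sum_repr' (ξ p)]
    refine Finset.sum_eq_zero fun i _ => ?_
    rw [Orthonormal.toBasis_apply, real_inner_comm, hall, zero_smul]
  have hne : ∀ᶠ y in 𝓝 p, V i y ≠ 0 := by
    have hVp : ⟪V i p, V i p⟫ ≠ 0 := by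
      rw [inner_self_ne_zero, (hVe i).self_of_nhds]
      have := hβ p
      exact smul_ne_zero (by positivity) (hξ0 p)
    have hc := ((hV i).self_of_nhds.inner (hV i).self_of_nhds).continuousAt
    filter_upwards [hc.eventually_ne hVp] with y hy h0
    exact hy (by rw [h0, inner_zero_left])
  obtain ⟨U, hU, hUo, hpU⟩ := eventually_nhds_iff.1 ((hV i).and ((hVe i).and hne))
  refine ⟨U, hUo, hpU, fun _ => V i, fun _ y hy => (hU y hy).1.contMDiffWithinAt, fun y hy => ?_⟩
  obtain ⟨-, h1, h2⟩ := hU y hy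
  refine ⟨linearIndependent_unique_iff.2 h2, ?_⟩
  rw [Set.range_const, h1, Submodule.span_singleton_smul_eq]
  rw [h1] at h2
  exact (left_ne_zero_of_smul h2).isUnit

lemma isQuasiSpaceForm_of_hasForm (h : ∀ p, HasForm (curvOp p) (ξ p) (α p) (β p))
    (hξ : ∀ p, ⟪ξ p, ξ p⟫ = 1) (hβ : ∀ p, β p ≠ 0) : IsQuasiSpaceForm 3 M := by
  refine ⟨1, le_rfl, by norm_num, fun p => Submodule.span ℝ {ξ p},
    isSmoothDistribution_span h hξ hβ, fun _ => ?_, fun h => absurd h (lt_irrefl 1)⟩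
  refine ⟨fun p => α p + β p, α, fun p hp => hβ p (by linarith), fun p X X' Y' hX hX' hY' ho θ _ => ?_⟩
  obtain ⟨c, rfl⟩ := Submodule.mem_span_singleton.1 hX
  rw [Submodule.mem_orthogonal_singleton_iff_inner_right] at hX' hY'
  have ho' := orthonormal_iff_ite.1 ho
  have o00 : ⟪c • ξ p, c • ξ p⟫ = 1 := ho' 0 0
  have o11 : ⟪X', X'⟫ = 1 := ho' 1 1
  have o22 : ⟪Y', Y'⟫ = 1 := ho' 2 2
  have o01 : ⟪c • ξ p, X'⟫ = 0 := ho' 0 1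
  have o02 : ⟪c • ξ p, Y'⟫ = 0 := ho' 0 2
  have o12 : ⟪X', Y'⟫ = 0 := ho' 1 2
  -- A unit vector of D is ξ up to sign, and only the square of the sign enters the curvature.
  have hc : c * c = 1 := by
    rwa [inner_smul_left, inner_smul_right, hξ, conj_trivial, mul_one] at o00
  have hξX : ⟪ξ p, c • ξ p⟫ = c := by rw [inner_smul_right, hξ, mul_one]
  generalize c • ξ p = X at o00 o01 o02 hξX ⊢
  have := (h p).sec_eq (v := Real.cos θ • X + Real.sin θ • X') (w := Y') ?_ o22 ?_ hY'
  · refine this.trans ?_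
    rw [inner_add_right, inner_smul_right, inner_smul_right, hX', hξX]
    linear_combination β p * Real.cos θ ^ 2 * hc - α p * Real.sin_sq_add_cos_sq θ
  · simp only [inner_add_left, inner_add_right, inner_smul_left, inner_smul_right, conj_trivial,
      real_inner_comm X X', o00, o01, o11]
    linear_combination Real.sin_sq_add_cos_sq θ
  · rw [inner_add_left, inner_smul_left, inner_smul_left, o02, o12]; simp

end RiemGeom

end

/-! ### The equivalence -/

theorem theorem3 {M : Type*} [TopologicalSpace M] [T2Space M] [SecondCountableTopology M]
    [ConnectedSpace M] [ChartedSpace (EuclideanSpace ℝ (Fin 3)) M] [IsManifold (𝓡 3) ∞ M]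
    [RiemannianBundle (fun p : M => TangentSpace (𝓡 3) p)]
    [IsContMDiffRiemannianBundle (𝓡 3) ∞ (EuclideanSpace ℝ (Fin 3))
      (fun p : M => TangentSpace (𝓡 3) p)]
    (hmult : RiemGeom.ConstantRicciMultiplicities 3 M) :
    RiemGeom.IsDeszczSymmetric 3 M ↔
      (RiemGeom.IsRealSpaceForm 3 M ∨ RiemGeom.IsQuasiSpaceForm 3 M) := by
  constructor
  · intro hD
    choose ξ α β hξ h using RiemGeom.exists_hasForm_of_isDeszczSymmetric hD
    -- Only multiplicity three matters: it separates the points with β = 0 from the others.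
    have hcount := fun p p' => hmult 3 (by norm_num) p p'
    simp only [RiemGeom.ncard_ricciMultiplicity_three (h _) (hξ _)] at hcount
    by_cases h0 : ∃ p, β p = 0
    · obtain ⟨p, hp⟩ := h0
      have hβ : ∀ p', β p' = 0 := by
        intro p'
        by_contra hne
        simpa [hp, hne] using hcount p p'
      exact Or.inl (RiemGeom.isRealSpaceForm_of_hasForm fun p' => hβ p' ▸ h p')
    · exact Or.inr (RiemGeom.isQuasiSpaceForm_of_hasForm h hξ fun p hp => h0 ⟨p, hp⟩)
  · rintro (h | h)
    · exact RiemGeom.isDeszczSymmetric_of_hasForm (RiemGeom.exists_hasForm_of_isRealSpaceForm h)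
    · exact RiemGeom.isDeszczSymmetric_of_hasForm (RiemGeom.exists_hasForm_of_isQuasiSpaceForm h)
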